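/- Let $k$ be a commutative ring. A map-graded category $(\mathcal U,\mathfrak a)$ consists of a small category $\mathcal U$ and a $\mathcal U$-graded $k$-linear category $\mathfrak a$ (objects over each object of $\mathcal U$, $k$-modules $\mathfrak a_u(A,B)$ over each morphism $u:U\to V$ of $\mathcal U$ and objects $A$ over $U$, $B$ over $V$, with associative unital composition). Let $\underline{\mathsf{Map}}$ be the bicategory of map-graded categories, bimodules and bimodule morphisms; a bimodule from $(\mathcal U,\mathfrak a)$ to $(\mathcal V,\mathfrak b)$ is a functor $S:\mathcal U^{op}\times\mathcal V\to\mathsf{Set}$ with $k$-modules $M_s(A,B)$, $s\in S(U,V)$, carrying compatible actions of $\mathfrak a$ and $\mathfrak b$, and composition is the coend of the $S$'s together with the tensor product of the $M$'s. Let $\mathcal C$ be a small category with finite products and let $(\mathcal U,\mathfrak a):\mathcal C\to\underline{\mathsf{Map}}$ be a pseudofunctor: $C\mapsto(\mathcal U_C,\mathfrak a_C)$ and $(c:C\to C')\mapsto(S_c,M_c)$, with coherent composition and unit isomorphisms. Its Grothendieck construction $(\tilde{\mathcal U},\tilde{\mathfrak a})$ is the map-graded category in which the objects of $\tilde{\mathcal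 U}$ are pairs $(C,U)$ with $U\in\mathcal U_C$, its morphisms $(C,U)\to(C',U')$ are pairs $(c,s)$ with $c:C\to C'$ and $s\in S_c(U,U')$, and $\tilde{\mathfrak a}_{(c,s)}(A,B)=M_{c,s}(A,B)$. Let $\mathcal C^*$ be $\mathcal C$ with a terminal object $*$ adjoined. For $C\in\mathcal C$ let $\tilde{\mathfrak a}|_C$ be the Grothendieck construction of the restriction of the pseudofunctor along $\mathcal C/C\to\mathcal C$, and let $\tilde{\mathfrak a}|_*=\tilde{\mathfrak a}$. This is a functor from $\mathcal C^*$ to the category $\mathsf{Map}_{sc}$ of map-graded categories and subcartesian graded functors (those inducing isomorphisms on all modules of morphisms). The Hochschild complex of $(\mathcal U,\mathfrak a)$ is $$\mathbf C^n(\mathfrak a)=\prod_{A_0\xrightarrow{u_0}A_1\to\cdots\xrightarrow{u_{n-1}}A_n}\mathrm{Hom}_k\bigl(\mathfrak a_{u_{n-1}}(A_{n-1},A_n)\otimes\cdots\otimes\mathfrak a_{u_0}(A_0,A_1),\ \mathfrak a_{u_{n-1}\cdots u_0}(A_0,A_n)\bigr),$$ where $A_0,\dots,A_n$ are objects of $\mathfrak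 a$ and $u_0,\dots,u_{n-1}$ are morphisms of $\mathcal U$ between the objects under them, with the Hochschild differential (the alternating sum of the cofaces). It is contravariantly functorial on $\mathsf{Map}_{sc}$ by $F^*\phi=F^{-1}\circ\phi\circ(F\otimes\cdots\otimes F)$. We consider the presheaf $$\mathcal F:(\mathcal C^*)^{op}\to\text{cochain complexes of }k\text{-modules},\qquad \mathcal F(C)=\mathbf C(\tilde{\mathfrak a}|_C),\quad \mathcal F(*)=\mathbf C(\tilde{\mathfrak a}).$$ Let $(C_i)_{i\in I}$ be a family of objects of $\mathcal C$ such that every object of $\mathcal C$ has a morphism to some $C_i$. Then: 1. All restriction maps of $\mathcal F$ (which are maps of complexes) preserve the cup product and the brace operations $x\{y_1,\dots,y_r\}$, i.e. the operations of the $B_\infty$-structure of Hochschild complexes. 2. $\mathcal F$ satisfies the sheaf property for the family $(C_i\to *)_{i\in I}$: for every cochain complex $E$, the presheaf of sets $\mathrm{Hom}(E,\mathcal F(-))$ on $\mathcal C^*$ satisfies the sheaf condition for this family. 3. Explicitly, for every $n$ and every family $x_i\in\mathcal F(C_i)^n$ such that, for all $i,j$, $x_i$ and $x_j$ have the same restriction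 to $C_i\times C_j$, there is a unique $x\in\mathcal F(*)^n$ restricting to $x_i$ for all $i$. (By 1 and 3, the maps $\mathcal F(*)\to\mathcal F(C_i)\rightrightarrows\mathcal F(C_i\times C_j)$ also give an equalizer diagram for the structure with these operations.) -/

import Mathlib

open CategoryTheory Opposite
open scoped TensorProduct

universe w u

set_option linter.unusedVariables false

namespace MapGraded

/-- A `U`-graded `k`-linear category `a`: objects `a_X` over every object `X` of `U`, and `k`-modules
`a_f(A, B)` over every morphism `f : X ⟶ Y` of `U`, with identities and composition.  A pair
`(U, a)` is a map-graded category.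

To avoid transport along equalities of morphisms of `U`, composition is indexed by proofs of
`f ≫ g = h`; since such proofs are unique, this is the same as a composition
`a_g(B, C) ⊗ a_f(A, B) → a_{g ∘ f}(A, C)`.  The same device is used throughout. -/
structure GradedCat (k : Type w) [CommRing k] (U : Type u) [SmallCategory U] where
  Obj : U → Type u
  Hom : ∀ {X Y : U}, (X ⟶ Y) → Obj X → Obj Y → Type u
  [addCommGroup : ∀ {X Y : U} (f : X ⟶ Y) (A : Obj X) (B : Obj Y), AddCommGroup (Hom f A B)]
  [module : ∀ {X Y : U} (f : X ⟶ Y) (A : Obj X) (B : Obj Y), Module k (Hom f A B)]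
  id : ∀ {X : U} (A : Obj X), Hom (𝟙 X) A A
  comp : ∀ {X Y Z : U} {f : X ⟶ Y} {g : Y ⟶ Z} {h : X ⟶ Z}, f ≫ g = h →
    ∀ {A : Obj X} {B : Obj Y} {C : Obj Z}, Hom g B C →ₗ[k] Hom f A B →ₗ[k] Hom h A C
  comp_id : ∀ {X Y : U} {f : X ⟶ Y} (e : 𝟙 X ≫ f = f) {A : Obj X} {B : Obj Y}
    (x : Hom f A B), comp e x (id A) = x
  id_comp : ∀ {X Y : U} {f : X ⟶ Y} (e : f ≫ 𝟙 Y = f) {A : Obj X} {B : Obj Y}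
    (x : Hom f A B), comp e (id B) x = x
  assoc : ∀ {X Y Z W : U} {f : X ⟶ Y} {g : Y ⟶ Z} {h : Z ⟶ W} {fg : X ⟶ Z} {gh : Y ⟶ W}
    {fgh : X ⟶ W} (e₁ : f ≫ g = fg) (e₂ : g ≫ h = gh) (e₃ : fg ≫ h = fgh) (e₄ : f ≫ gh = fgh)
    {A : Obj X} {B : Obj Y} {C : Obj Z} {D : Obj W}
    (z : Hom h C D) (y : Hom g B C) (x : Hom f A B),
    comp e₃ z (comp e₁ y x) = comp e₄ (comp e₂ z y) x

attribute [instance] GradedCat.addCommGroup GradedCat.module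

section Bimodules

/-- The categorical part of a `U`-`V`-bimodule: a functor `S : Vᵒᵖ × U ⥤ Type`. -/
abbrev Bifunctor (U V : Type u) [SmallCategory U] [SmallCategory V] := Vᵒᵖ × U ⥤ Type u

variable {U V W : Type u} [SmallCategory U] [SmallCategory V] [SmallCategory W]

/-- The two-sided action `g s f` of morphisms on elements of `S`. -/
def Bifunctor.act (S : Bifunctor U V) {X X' : V} {Y Y' : U} (g : Y ⟶ Y') (s : S.obj (op X, Y))
    (f : X' ⟶ X) : S.obj (op X', Y') :=
  S.map (X := (op X, Y)) (Y := (op X', Y')) (f.op, g) s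

theorem Bifunctor.act_id (S : Bifunctor U V) {X : V} {Y : U} (s : S.obj (op X, Y)) :
    S.act (𝟙 Y) s (𝟙 X) = s := by
  have := ConcreteCategory.congr_hom (S.map_id (op X, Y)) s
  exact this

theorem Bifunctor.act_act (S : Bifunctor U V) {X X' X'' : V} {Y Y' Y'' : U} (g : Y ⟶ Y')
    (g' : Y' ⟶ Y'') (s : S.obj (op X, Y)) (f : X' ⟶ X) (f' : X'' ⟶ X') :
    S.act g' (S.act g s f) f' = S.act (g ≫ g') s (f' ≫ f) := by
  have := ConcreteCategory.congr_hom (S.map_comp (X := (op X, Y)) (Y := (op X', Y'))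
    (Z := (op X'', Y'')) (f.op, g) (f'.op, g')) s
  exact this.symm

/-- The relation `(s f, t) ∼ (s, f t)` whose quotient is the coend `∐_Y S(Y, X) × T(Z, Y) / ∼`. -/
inductive Bifunctor.Rel (S : Bifunctor U V) (T : Bifunctor V W) (Z : W) (X : U) :
    (Σ Y : V, S.obj (op Y, X) × T.obj (op Z, Y)) →
      (Σ Y : V, S.obj (op Y, X) × T.obj (op Z, Y)) → Prop
  | slide {Y Y' : V} (s : S.obj (op Y, X)) (f : Y' ⟶ Y) (t : T.obj (op Z, Y')) :
      Rel S T Z X ⟨Y', S.act (𝟙 X) s f, t⟩ ⟨Y, s, T.act f t (𝟙 Z)⟩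

/-- The composition `S ∘ T` of bifunctors (profunctors), a coend over the middle category. -/
def Bifunctor.comp (S : Bifunctor U V) (T : Bifunctor V W) : Bifunctor U W where
  obj p := Quot (Bifunctor.Rel S T p.1.unop p.2)
  map {p q} h := TypeCat.ofHom (Quot.map
    (fun x => ⟨x.1, S.act h.2 x.2.1 (𝟙 x.1), T.act (𝟙 x.1) x.2.2 h.1.unop⟩) (by
      rintro _ _ ⟨s, f, t⟩
      have h₁ := Bifunctor.Rel.slide (S := S) (T := T) (Z := q.1.unop) (X := q.2)
        (S.act h.2 s (𝟙 _)) f (T.act (𝟙 _) t h.1.unop)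
      simpa [Bifunctor.act_act] using h₁))
  map_id p := by
    ext x
    induction x using Quot.ind with | _ x
    simp [Quot.map, Bifunctor.act_id]
  map_comp f g := by
    ext x
    induction x using Quot.ind with | _ x
    simp [Quot.map, Bifunctor.act_act]

/-- The class of the pair `(s, t)` in `S ∘ T`. -/
def Bifunctor.pair (S : Bifunctor U V) (T : Bifunctor V W) {Z : W} {X : U} {Y : V}
    (s : S.obj (op Y, X)) (t : T.obj (op Z, Y)) : (S.comp T).obj (op Z, X) :=
  Quot.mk (Bifunctor.Rel S T Z X) ⟨Y, s, t⟩

theorem Bifunctor.pair_slide (S : Bifunctor U V) (T : Bifunctor V W) {Z : W} {X : U} {Y Y' : V}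
    (s : S.obj (op Y, X)) (f : Y' ⟶ Y) (t : T.obj (op Z, Y')) :
    S.pair T (S.act (𝟙 X) s f) t = S.pair T s (T.act f t (𝟙 Z)) :=
  Quot.sound (Bifunctor.Rel.slide s f t)

theorem Bifunctor.comp_act (S : Bifunctor U V) (T : Bifunctor V W) {Z Z' : W} {X X' : U} {Y : V}
    (g : X ⟶ X') (s : S.obj (op Y, X)) (t : T.obj (op Z, Y)) (f : Z' ⟶ Z) :
    (S.comp T).act g (S.pair T s t) f = S.pair T (S.act g s (𝟙 Y)) (T.act (𝟙 Y) t f) := rfl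

variable {k : Type w} [CommRing k]

/-- Three-fold composition in a graded category. -/
def GradedCat.comp₃ (a : GradedCat k U) {X' X Y Y' : U} {f : X' ⟶ X} {s : X ⟶ Y} {g : Y ⟶ Y'}
    {t : X' ⟶ Y'} (e : f ≫ s ≫ g = t) {A' : a.Obj X'} {A : a.Obj X} {B : a.Obj Y}
    {B' : a.Obj Y'} : a.Hom g B B' →ₗ[k] a.Hom s A B →ₗ[k] a.Hom f A' A →ₗ[k] a.Hom t A' B' :=
  LinearMap.llcomp k _ _ _ (a.comp (f := f) (g := s ≫ g) e) ∘ₗ a.comp (f := s) (g := g) rfl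

theorem GradedCat.comp₃_apply (a : GradedCat k U) {X' X Y Y' : U} {f : X' ⟶ X} {s : X ⟶ Y}
    {g : Y ⟶ Y'} {t : X' ⟶ Y'} (e : f ≫ s ≫ g = t) {A' : a.Obj X'} {A : a.Obj X} {B : a.Obj Y}
    {B' : a.Obj Y'} (z : a.Hom g B B') (y : a.Hom s A B) (x : a.Hom f A' A) :
    a.comp₃ e z y x = a.comp e (a.comp rfl z y) x := rfl

theorem GradedCat.comp₃_id (a : GradedCat k U) {X Y : U} {s : X ⟶ Y} (e : 𝟙 X ≫ s ≫ 𝟙 Y = s)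
    {A : a.Obj X} {B : a.Obj Y} (m : a.Hom s A B) : a.comp₃ e (a.id B) m (a.id A) = m := by
  have h : ∀ {s' : X ⟶ Y} (h₁ : s ≫ 𝟙 Y = s') (h₂ : 𝟙 X ≫ s' = s),
      a.comp h₂ (a.comp h₁ (a.id B) m) (a.id A) = m := by
    intro s' h₁ h₂
    obtain rfl : s = s' := by simpa using h₁
    rw [a.comp_id, a.id_comp]
  exact h rfl e

theorem GradedCat.comp₃_comp₃ (a : GradedCat k U) {X X' X'' Y Y' Y'' : U} {g : Y ⟶ Y'}
    {g' : Y' ⟶ Y''} {gg' : Y ⟶ Y''} {f : X' ⟶ X} {f' : X'' ⟶ X'} {f'f : X'' ⟶ X} {s : X ⟶ Y}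
    {t : X' ⟶ Y'} {r : X'' ⟶ Y''} (eg : g ≫ g' = gg') (ef : f' ≫ f = f'f)
    (e₁ : f ≫ s ≫ g = t) (e₂ : f' ≫ t ≫ g' = r) (e₃ : f'f ≫ s ≫ gg' = r)
    {B : a.Obj X} {B' : a.Obj X'} {B'' : a.Obj X''} {A : a.Obj Y} {A' : a.Obj Y'} {A'' : a.Obj Y''}
    (x' : a.Hom g' A' A'') (x : a.Hom g A A') (m : a.Hom s B A) (y : a.Hom f B' B)
    (y' : a.Hom f' B'' B') :
    a.comp₃ e₂ x' (a.comp₃ e₁ x m y) y' = a.comp₃ e₃ (a.comp eg x' x) m (a.comp ef y y') := by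
  have q : f ≫ (s ≫ g) ≫ g' = t ≫ g' := by simp [← e₁]
  have w : s ≫ gg' = (s ≫ g) ≫ g' := by simp [← eg]
  have z : f'f ≫ (s ≫ g) ≫ g' = r := by simp [← e₃, ← eg]
  have key : ∀ {p p' : X ⟶ Y''} (h : s ≫ gg' = p) (h' : s ≫ gg' = p') (hp : f'f ≫ p = r)
      (hp' : f'f ≫ p' = r), a.comp hp (a.comp h (a.comp eg x' x) m) (a.comp ef y y') =
        a.comp hp' (a.comp h' (a.comp eg x' x) m) (a.comp ef y y') := by
    rintro p p' rfl rfl hp hp'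
    rfl
  simp only [a.comp₃_apply]
  rw [a.assoc e₁ rfl rfl q, ← a.assoc ef q z e₂, a.assoc rfl eg rfl w]
  exact key _ _ _ _

/-- The linear part of an `a`-`b`-bimodule over the bifunctor `S`: a `k`-module `M_s(B, A)` for every
`s ∈ S(X, Y)`, `B` over `X`, `A` over `Y`, with a two-sided action
`a_g(A, A') ⊗ M_s(B, A) ⊗ b_f(B', B) → M_{g s f}(B', A')`. -/
structure Bimodule (a : GradedCat k U) (b : GradedCat k V) (S : Bifunctor U V) where
  Elt : ∀ {X : V} {Y : U}, S.obj (op X, Y) → b.Obj X → a.Obj Y → Type u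
  [addCommGroup : ∀ {X : V} {Y : U} (s : S.obj (op X, Y)) (B : b.Obj X) (A : a.Obj Y),
    AddCommGroup (Elt s B A)]
  [module : ∀ {X : V} {Y : U} (s : S.obj (op X, Y)) (B : b.Obj X) (A : a.Obj Y),
    Module k (Elt s B A)]
  act : ∀ {X X' : V} {Y Y' : U} {g : Y ⟶ Y'} {s : S.obj (op X, Y)} {f : X' ⟶ X}
    {t : S.obj (op X', Y')}, S.act g s f = t →
    ∀ {B : b.Obj X} {B' : b.Obj X'} {A : a.Obj Y} {A' : a.Obj Y'},
      a.Hom g A A' →ₗ[k] Elt s B A →ₗ[k] b.Hom f B' B →ₗ[k] Elt t B' A'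
  act_id : ∀ {X : V} {Y : U} {s : S.obj (op X, Y)} (e : S.act (𝟙 Y) s (𝟙 X) = s)
    {B : b.Obj X} {A : a.Obj Y} (m : Elt s B A), act e (a.id A) m (b.id B) = m
  act_act : ∀ {X X' X'' : V} {Y Y' Y'' : U} {g : Y ⟶ Y'} {g' : Y' ⟶ Y''} {gg' : Y ⟶ Y''}
    {f : X' ⟶ X} {f' : X'' ⟶ X'} {f'f : X'' ⟶ X} {s : S.obj (op X, Y)}
    {t : S.obj (op X', Y')} {r : S.obj (op X'', Y'')}
    (eg : g ≫ g' = gg') (ef : f' ≫ f = f'f) (e₁ : S.act g s f = t) (e₂ : S.act g' t f' = r)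
    (e₃ : S.act gg' s f'f = r)
    {B : b.Obj X} {B' : b.Obj X'} {B'' : b.Obj X''} {A : a.Obj Y} {A' : a.Obj Y'} {A'' : a.Obj Y''}
    (x' : a.Hom g' A' A'') (x : a.Hom g A A') (m : Elt s B A) (y : b.Hom f B' B)
    (y' : b.Hom f' B'' B'),
    act e₂ x' (act e₁ x m y) y' = act e₃ (a.comp eg x' x) m (b.comp ef y y')

attribute [instance] Bimodule.addCommGroup Bimodule.module

/-- The identity bimodule of `(U, a)`: the bifunctor `U(-, -)` and the modules `a_f(A, B)`. -/
def idBimodule (a : GradedCat k U) : Bimodule a a (Functor.hom U) where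
  Elt {X Y} s B A := a.Hom (X := X) (Y := Y) s B A
  addCommGroup {X Y} s B A := a.addCommGroup (X := X) (Y := Y) s B A
  module {X Y} s B A := a.module (X := X) (Y := Y) s B A
  act {X X' Y Y' g s f t} e {B B' A A'} :=
    a.comp₃ (X' := X') (X := X) (Y := Y) (Y' := Y') (f := f) (s := s) (g := g) (t := t) e
  act_id {X Y s} e {B A} m := a.comp₃_id (X := X) (Y := Y) (s := s) e m
  act_act {X X' X'' Y Y' Y'' g g' gg' f f' f'f s t r} eg ef e₁ e₂ e₃ {B B' B'' A A' A''} x' x m y y' :=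
    a.comp₃_comp₃ (s := s) (t := t) (r := r) eg ef e₁ e₂ e₃ x' x m y y'

section Tensor

variable {a : GradedCat k U} {b : GradedCat k V} {c : GradedCat k W}
  {S : Bifunctor U V} {T : Bifunctor V W}

/-- An index of the direct sum computing `(M ⊗_b N)_r`: a representative `(s, t)` of `r` and a middle object. -/
structure TensorIndex (b : GradedCat k V) (S : Bifunctor U V) (T : Bifunctor V W)
    {Z : W} {X : U} (r : (S.comp T).obj (op Z, X)) where
  base : V
  left : S.obj (op base, X)
  right : T.obj (op Z, base)
  mid : b.Obj base
  eq : S.pair T left right = r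

/-- The direct sum of the modules `M_s(B, A) ⊗ N_t(C, B)` over all `(s, t)` representing `r`. -/
abbrev TensorSum (M : Bimodule a b S) (N : Bimodule b c T) {Z : W} {X : U}
    (r : (S.comp T).obj (op Z, X)) (C : c.Obj Z) (A : a.Obj X) : Type u :=
  DirectSum (TensorIndex b S T r) fun i => M.Elt i.left i.mid A ⊗[k] N.Elt i.right C i.mid

open Classical in
noncomputable def tensorOf (M : Bimodule a b S) (N : Bimodule b c T) {Z : W} {X : U}
    {r : (S.comp T).obj (op Z, X)} (C : c.Obj Z) (A : a.Obj X) (i : TensorIndex b S T r) :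
    M.Elt i.left i.mid A ⊗[k] N.Elt i.right C i.mid →ₗ[k] TensorSum M N r C A :=
  DirectSum.lof k (TensorIndex b S T r)
    (fun i => M.Elt i.left i.mid A ⊗[k] N.Elt i.right C i.mid) i

/-- The elements `m y ⊗ n - m ⊗ y n`, where `y` is in the middle graded category. -/
inductive TensorRel (M : Bimodule a b S) (N : Bimodule b c T) {Z : W} {X : U}
    (r : (S.comp T).obj (op Z, X)) (C : c.Obj Z) (A : a.Obj X) : TensorSum M N r C A → Prop
  | slide {Y Y' : V} {s : S.obj (op Y, X)} {f : Y' ⟶ Y} {t : T.obj (op Z, Y')}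
      {B : b.Obj Y} {B' : b.Obj Y'} (m : M.Elt s B A) (y : b.Hom f B' B) (n : N.Elt t C B')
      (e : S.pair T (S.act (𝟙 X) s f) t = r) (e' : S.pair T s (T.act f t (𝟙 Z)) = r) :
      TensorRel M N r C A
        (tensorOf M N C A ⟨Y', S.act (𝟙 X) s f, t, B', e⟩
            (M.act rfl (a.id A) m y ⊗ₜ[k] n) -
          tensorOf M N C A ⟨Y, s, T.act f t (𝟙 Z), B, e'⟩
            (m ⊗ₜ[k] N.act rfl y n (c.id C)))

/-- The module `(M ⊗_b N)_r(C, A)`. -/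
abbrev TensorElt (M : Bimodule a b S) (N : Bimodule b c T) {Z : W} {X : U}
    (r : (S.comp T).obj (op Z, X)) (C : c.Obj Z) (A : a.Obj X) : Type u :=
  TensorSum M N r C A ⧸ Submodule.span k {x | TensorRel M N r C A x}

/-- The class of `m ⊗ n`. -/
noncomputable def tensorMk (M : Bimodule a b S) (N : Bimodule b c T) {Z : W} {X : U} {Y : V}
    {s : S.obj (op Y, X)} {t : T.obj (op Z, Y)} {r : (S.comp T).obj (op Z, X)}
    (e : S.pair T s t = r) {C : c.Obj Z} {B : b.Obj Y} {A : a.Obj X} :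
    M.Elt s B A →ₗ[k] N.Elt t C B →ₗ[k] TensorElt M N r C A :=
  (TensorProduct.mk k _ _).compr₂
    ((Submodule.mkQ _) ∘ₗ tensorOf M N C A (r := r) ⟨Y, s, t, B, e⟩)

theorem tensorMk_slide (M : Bimodule a b S) (N : Bimodule b c T) {Z : W} {X : U}
    {r : (S.comp T).obj (op Z, X)} {C : c.Obj Z} {A : a.Obj X}
    {Y Y' : V} {s : S.obj (op Y, X)} {f : Y' ⟶ Y} {t : T.obj (op Z, Y')}
    {s' : S.obj (op Y', X)} {t' : T.obj (op Z, Y)} (es : S.act (𝟙 X) s f = s')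
    (et : T.act f t (𝟙 Z) = t')
    {B : b.Obj Y} {B' : b.Obj Y'} (m : M.Elt s B A) (y : b.Hom f B' B) (n : N.Elt t C B')
    (e : S.pair T s' t = r) (e' : S.pair T s t' = r) :
    tensorMk M N e (M.act es (a.id A) m y) n = tensorMk M N e' m (N.act et y n (c.id C)) := by
  subst es et
  rw [← sub_eq_zero]
  refine (Submodule.Quotient.mk_eq_zero _).2 (Submodule.subset_span ?_)
  exact TensorRel.slide m y n e e'

theorem tensor_hom_ext {M : Bimodule a b S} {N : Bimodule b c T} {Z : W} {X : U}
    {r : (S.comp T).obj (op Z, X)} {C : c.Obj Z} {A : a.Obj X} {Q : Type*} [AddCommGroup Q]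
    [Module k Q] {F G : TensorElt M N r C A →ₗ[k] Q}
    (h : ∀ {Y : V} {s : S.obj (op Y, X)} {t : T.obj (op Z, Y)} (e : S.pair T s t = r)
      {B : b.Obj Y} (m : M.Elt s B A) (n : N.Elt t C B),
      F (tensorMk M N e m n) = G (tensorMk M N e m n)) : F = G := by
  classical
  refine Submodule.linearMap_qext _ (DirectSum.linearMap_ext k fun i => ?_)
  refine TensorProduct.ext' fun m n => ?_
  exact h i.eq m n

noncomputable def tensorDesc {M : Bimodule a b S} {N : Bimodule b c T} {Z : W} {X : U}
    {r : (S.comp T).obj (op Z, X)} {C : c.Obj Z} {A : a.Obj X} {Q : Type u} [AddCommGroup Q]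
    [Module k Q]
    (β : ∀ {Y : V} {s : S.obj (op Y, X)} {t : T.obj (op Z, Y)}, S.pair T s t = r →
      ∀ {B : b.Obj Y}, M.Elt s B A →ₗ[k] N.Elt t C B →ₗ[k] Q)
    (hβ : ∀ {Y Y' : V} {s : S.obj (op Y, X)} {f : Y' ⟶ Y} {t : T.obj (op Z, Y')}
      {B : b.Obj Y} {B' : b.Obj Y'} (m : M.Elt s B A) (y : b.Hom f B' B) (n : N.Elt t C B')
      (e : S.pair T (S.act (𝟙 X) s f) t = r) (e' : S.pair T s (T.act f t (𝟙 Z)) = r),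
      β e (M.act rfl (a.id A) m y) n = β e' m (N.act rfl y n (c.id C))) :
    TensorElt M N r C A →ₗ[k] Q := by
  classical
  exact Submodule.liftQ _ (DirectSum.toModule k _ _ fun i => TensorProduct.lift (β i.eq)) (by
    rw [Submodule.span_le]
    rintro _ ⟨m, y, n, e₁, e₂⟩
    rw [SetLike.mem_coe, LinearMap.mem_ker, map_sub, sub_eq_zero]
    unfold tensorOf
    rw [DirectSum.toModule_lof, DirectSum.toModule_lof]
    exact hβ m y n e₁ e₂)

theorem tensorDesc_mk {M : Bimodule a b S} {N : Bimodule b c T} {Z : W} {X : U}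
    {r : (S.comp T).obj (op Z, X)} {C : c.Obj Z} {A : a.Obj X} {Q : Type u} [AddCommGroup Q]
    [Module k Q]
    (β : ∀ {Y : V} {s : S.obj (op Y, X)} {t : T.obj (op Z, Y)}, S.pair T s t = r →
      ∀ {B : b.Obj Y}, M.Elt s B A →ₗ[k] N.Elt t C B →ₗ[k] Q)
    (hβ : ∀ {Y Y' : V} {s : S.obj (op Y, X)} {f : Y' ⟶ Y} {t : T.obj (op Z, Y')}
      {B : b.Obj Y} {B' : b.Obj Y'} (m : M.Elt s B A) (y : b.Hom f B' B) (n : N.Elt t C B')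
      (e : S.pair T (S.act (𝟙 X) s f) t = r) (e' : S.pair T s (T.act f t (𝟙 Z)) = r),
      β e (M.act rfl (a.id A) m y) n = β e' m (N.act rfl y n (c.id C)))
    {Y : V} {s : S.obj (op Y, X)} {t : T.obj (op Z, Y)} (e : S.pair T s t = r) {B : b.Obj Y}
    (m : M.Elt s B A) (n : N.Elt t C B) :
    tensorDesc (M := M) (N := N) β hβ (tensorMk M N e m n) = β e m n := by
  classical
  unfold tensorDesc tensorMk tensorOf
  simp only [LinearMap.compr₂_apply, LinearMap.comp_apply, Submodule.mkQ_apply,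
    Submodule.liftQ_apply, TensorProduct.mk_apply]
  rw [DirectSum.toModule_lof]
  rfl

theorem pair_act {Z Z' : W} {X X' : U} {Y : V} {s : S.obj (op Y, X)} {t : T.obj (op Z, Y)}
    {r : (S.comp T).obj (op Z, X)} {r' : (S.comp T).obj (op Z', X')} {g : X ⟶ X'} {f : Z' ⟶ Z}
    (e : (S.comp T).act g r f = r') (e' : S.pair T s t = r) :
    S.pair T (S.act g s (𝟙 Y)) (T.act (𝟙 Y) t f) = r' :=
  (Bifunctor.comp_act S T g s t f).symm.trans
    ((congrArg (fun q => (S.comp T).act g q f) e').trans e)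

theorem pair_act' {Z Z' : W} {X X' : U} {Y : V} {s : S.obj (op Y, X)} {t : T.obj (op Z, Y)}
    {r : (S.comp T).obj (op Z, X)} {r' : (S.comp T).obj (op Z', X')} {g : X ⟶ X'} {f : Z' ⟶ Z}
    {s' : S.obj (op Y, X')} {t' : T.obj (op Z', Y)} (es : S.act g s (𝟙 Y) = s')
    (et : T.act (𝟙 Y) t f = t')
    (e : (S.comp T).act g r f = r') (e' : S.pair T s t = r) :
    S.pair T s' t' = r' := by
  subst es et
  exact pair_act e e'

noncomputable def tensorActAux (M : Bimodule a b S) (N : Bimodule b c T) {Z Z' : W} {X X' : U}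
    {r : (S.comp T).obj (op Z, X)} {r' : (S.comp T).obj (op Z', X')} {g : X ⟶ X'} {f : Z' ⟶ Z}
    (e : (S.comp T).act g r f = r') {C : c.Obj Z} {C' : c.Obj Z'} {A : a.Obj X} {A' : a.Obj X'}
    (x : a.Hom g A A') (z : c.Hom f C' C) {Y : V} {s : S.obj (op Y, X)} {t : T.obj (op Z, Y)}
    (e' : S.pair T s t = r) {B : b.Obj Y} :
    M.Elt s B A →ₗ[k] N.Elt t C B →ₗ[k] TensorElt M N r' C' A' :=
  (tensorMk M N (pair_act e e')).compl₁₂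
    ((M.act (rfl : S.act g s (𝟙 Y) = _) x).flip (b.id B))
    ((N.act (rfl : T.act (𝟙 Y) t f = _) (b.id B)).flip z)

theorem tensorActAux_slide (M : Bimodule a b S) (N : Bimodule b c T) {Z Z' : W} {X X' : U}
    {r : (S.comp T).obj (op Z, X)} {r' : (S.comp T).obj (op Z', X')} {g : X ⟶ X'} {f : Z' ⟶ Z}
    (e : (S.comp T).act g r f = r') {C : c.Obj Z} {C' : c.Obj Z'} {A : a.Obj X} {A' : a.Obj X'}
    (x : a.Hom g A A') (z : c.Hom f C' C) {Y Y' : V} {s : S.obj (op Y, X)} {h : Y' ⟶ Y}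
    {t : T.obj (op Z, Y')} {B : b.Obj Y} {B' : b.Obj Y'} (m : M.Elt s B A) (y : b.Hom h B' B)
    (n : N.Elt t C B') (e₁ : S.pair T (S.act (𝟙 X) s h) t = r)
    (e₂ : S.pair T s (T.act h t (𝟙 Z)) = r) :
    tensorActAux M N e x z e₁ (M.act rfl (a.id A) m y) n =
      tensorActAux M N e x z e₂ m (N.act rfl y n (c.id C)) := by
  simp only [tensorActAux, LinearMap.compl₁₂_apply, LinearMap.flip_apply]
  have e₃ : S.act (𝟙 X') (S.act g s (𝟙 Y)) h = S.act g (S.act (𝟙 X) s h) (𝟙 Y') := by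
    simp [Bifunctor.act_act]
  have e₄ : T.act h (T.act (𝟙 Y') t f) (𝟙 Z') = T.act (𝟙 Y) (T.act h t (𝟙 Z)) f := by
    simp [Bifunctor.act_act]
  have hm : M.act (rfl : S.act g (S.act (𝟙 X) s h) (𝟙 Y') = _) x
        (M.act (rfl : S.act (𝟙 X) s h = _) (a.id A) m y) (b.id B') =
      M.act e₃ (a.id A') (M.act rfl x m (b.id B)) y := by
    rw [M.act_act (gg' := g) (f'f := h) (by simp) (by simp) _ _ (by simp [Bifunctor.act_act]),
      M.act_act (gg' := g) (f'f := h) (by simp) (by simp) _ _ (by simp [Bifunctor.act_act]),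
      a.comp_id, a.id_comp, b.comp_id, b.id_comp]
  have hn : N.act (rfl : T.act (𝟙 Y) (T.act h t (𝟙 Z)) f = _) (b.id B)
        (N.act (rfl : T.act h t (𝟙 Z) = _) y n (c.id C)) z =
      N.act e₄ y (N.act rfl (b.id B') n z) (c.id C') := by
    rw [N.act_act (gg' := h) (f'f := f) (by simp) (by simp) _ _ (by simp [Bifunctor.act_act]),
      N.act_act (gg' := h) (f'f := f) (by simp) (by simp) _ _ (by simp [Bifunctor.act_act]),
      b.comp_id, b.id_comp, c.comp_id, c.id_comp]
  rw [hm, hn]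
  exact tensorMk_slide M N e₃ e₄ _ y _ _ _

noncomputable def tensorAct (M : Bimodule a b S) (N : Bimodule b c T) {Z Z' : W} {X X' : U}
    {r : (S.comp T).obj (op Z, X)} {r' : (S.comp T).obj (op Z', X')} {g : X ⟶ X'} {f : Z' ⟶ Z}
    (e : (S.comp T).act g r f = r') {C : c.Obj Z} {C' : c.Obj Z'} {A : a.Obj X} {A' : a.Obj X'}
    (x : a.Hom g A A') (z : c.Hom f C' C) : TensorElt M N r C A →ₗ[k] TensorElt M N r' C' A' :=
  tensorDesc (fun e' => tensorActAux M N e x z e')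
    (fun m y n e₁ e₂ => tensorActAux_slide M N e x z m y n e₁ e₂)

theorem tensorAct_mk (M : Bimodule a b S) (N : Bimodule b c T) {Z Z' : W} {X X' : U} {Y : V}
    {s : S.obj (op Y, X)} {t : T.obj (op Z, Y)} {g : X ⟶ X'} {f : Z' ⟶ Z}
    {s' : S.obj (op Y, X')} {t' : T.obj (op Z', Y)}
    {r : (S.comp T).obj (op Z, X)} {r' : (S.comp T).obj (op Z', X')}
    (es : S.act g s (𝟙 Y) = s') (et : T.act (𝟙 Y) t f = t')
    (e : (S.comp T).act g r f = r') (e₁ : S.pair T s t = r) (e₂ : S.pair T s' t' = r')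
    {C : c.Obj Z} {C' : c.Obj Z'} {A : a.Obj X} {A' : a.Obj X'} {B : b.Obj Y}
    (x : a.Hom g A A') (z : c.Hom f C' C) (m : M.Elt s B A) (n : N.Elt t C B) :
    tensorAct M N e x z (tensorMk M N e₁ m n) =
      tensorMk M N e₂ (M.act es x m (b.id B)) (N.act et (b.id B) n z) := by
  subst es et
  exact tensorDesc_mk (fun e' => tensorActAux M N e x z e')
    (fun m y n e₁ e₂ => tensorActAux_slide M N e x z m y n e₁ e₂) e₁ m n

/-- The tensor product `M ⊗_b N`, an `a`-`c`-bimodule over the composed bifunctor `S ∘ T`. -/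
noncomputable def Bimodule.tensor (M : Bimodule a b S) (N : Bimodule b c T) :
    Bimodule a c (S.comp T) where
  Elt r C A := TensorElt M N r C A
  act {Z Z' X X' g r f r'} e {C C' A A'} :=
    LinearMap.lflip.toLinearMap ∘ₗ LinearMap.mk₂ k (fun x z => tensorAct M N e x z)
      (fun x x' z => tensor_hom_ext fun e₁ B m n => by
        simp [tensorAct_mk M N rfl rfl e e₁ (pair_act e e₁)])
      (fun q x z => tensor_hom_ext fun e₁ B m n => by
        simp [tensorAct_mk M N rfl rfl e e₁ (pair_act e e₁)])
      (fun x z z' => tensor_hom_ext fun e₁ B m n => by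
        simp [tensorAct_mk M N rfl rfl e e₁ (pair_act e e₁)])
      (fun q x z => tensor_hom_ext fun e₁ B m n => by
        simp [tensorAct_mk M N rfl rfl e e₁ (pair_act e e₁)])
  act_id {Z X r} e {C A} m := by
    change tensorAct M N e (a.id A) (c.id C) m = (LinearMap.id : TensorElt M N r C A →ₗ[k] TensorElt M N r C A) m
    refine LinearMap.congr_fun (tensor_hom_ext fun {Y s t} e₁ {B} m n => ?_) m
    rw [tensorAct_mk M N (s' := s) (t' := t) (S.act_id s) (T.act_id t) e e₁ e₁, M.act_id, N.act_id]
    rfl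
  act_act {Z Z' Z'' X X' X'' g g' gg' f f' f'f r r' r''} eg ef e₁ e₂ e₃ {C C' C'' A A' A''}
      x' x m z z' := by
    change (tensorAct M N e₂ x' z' ∘ₗ tensorAct M N e₁ x z) m =
      tensorAct M N e₃ (a.comp eg x' x) (c.comp ef z z') m
    refine LinearMap.congr_fun (tensor_hom_ext fun {Y s t} e {B} m n => ?_) m
    subst eg ef
    have es : S.act g' (S.act g s (𝟙 Y)) (𝟙 Y) = S.act (g ≫ g') s (𝟙 Y) := by
      simp [Bifunctor.act_act]
    have et : T.act (𝟙 Y) (T.act (𝟙 Y) t f) f' = T.act (𝟙 Y) t (f' ≫ f) := by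
      simp [Bifunctor.act_act]
    rw [LinearMap.comp_apply, tensorAct_mk M N rfl rfl e₁ e (pair_act e₁ e),
      tensorAct_mk M N es et e₂ _ (pair_act' rfl rfl e₃ e),
      tensorAct_mk M N rfl rfl e₃ e (pair_act' rfl rfl e₃ e),
      M.act_act (gg' := g ≫ g') (f'f := 𝟙 Y) rfl (by simp) _ _ rfl,
      N.act_act (gg' := 𝟙 Y) (f'f := f' ≫ f) (by simp) rfl _ _ rfl, b.comp_id]

end Tensor

/-- An isomorphism `(φ, F) : (S, M) ≅ (S', M')` of bimodules: a natural isomorphism `φ : S ≅ S'`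
and isomorphisms `M_s(B, A) ≅ M'_{φ(s)}(B, A)` compatible with the actions.
(The equation `e'` is a consequence of `e`, by naturality.) -/
structure BimoduleIso {a : GradedCat k U} {b : GradedCat k V} {S S' : Bifunctor U V}
    (M : Bimodule a b S) (M' : Bimodule a b S') where
  base : S ≅ S'
  fib : ∀ {X : V} {Y : U} (s : S.obj (op X, Y)) (B : b.Obj X) (A : a.Obj Y),
    M.Elt s B A ≃ₗ[k] M'.Elt (X := X) (Y := Y) (base.hom.app (op X, Y) s) B A
  fib_act : ∀ {X X' : V} {Y Y' : U} {g : Y ⟶ Y'} {s : S.obj (op X, Y)} {f : X' ⟶ X}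
    {t : S.obj (op X', Y')} (e : S.act g s f = t)
    (e' : S'.act g (base.hom.app (op X, Y) s) f = base.hom.app (op X', Y') t)
    {B : b.Obj X} {B' : b.Obj X'} {A : a.Obj Y} {A' : a.Obj Y'}
    (x : a.Hom g A A') (m : M.Elt s B A) (y : b.Hom f B' B),
    fib t B' A' (M.act e x m y) = M'.act e' x (fib s B A m) y

/-- Transport of elements of a bimodule along an equality of indices. -/
def Bimodule.reindex {a : GradedCat k U} {b : GradedCat k V} {S : Bifunctor U V}
    (M : Bimodule a b S) {X : V} {Y : U} {s t : S.obj (op X, Y)} (e : s = t) (B : b.Obj X)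
    (A : a.Obj Y) : M.Elt s B A ≃ₗ[k] M.Elt t B A :=
  e ▸ LinearEquiv.refl k (M.Elt s B A)

end Bimodules

/-- The data of a pseudofunctor from the category `C` to the bicategory of map-graded categories,
bimodules and bimodule morphisms: a map-graded category `(U_X, a_X)` for every object, an
`a_Y`-`a_X`-bimodule `(S_c, M_c)` for every `c : X ⟶ Y`, isomorphisms
`(S_d ∘ S_c, M_d ⊗ M_c) ≅ (S_{d c}, M_{d c})`, and isomorphisms of the identity bimodules with
`(S_1, M_1)`. -/
structure MapPrePseudofunctor (k : Type w) [CommRing k] (C : Type u) [SmallCategory C] where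
  base : C → Type u
  [cat : ∀ X : C, SmallCategory (base X)]
  fib : ∀ X : C, GradedCat k (base X)
  bfun : ∀ {X Y : C}, (X ⟶ Y) → Bifunctor (base Y) (base X)
  bmod : ∀ {X Y : C} (c : X ⟶ Y), Bimodule (fib Y) (fib X) (bfun c)
  mapComp : ∀ {X Y Z : C} {c : X ⟶ Y} {d : Y ⟶ Z} {e : X ⟶ Z}, c ≫ d = e →
    BimoduleIso ((bmod d).tensor (bmod c)) (bmod e)
  mapId : ∀ {X : C} {c : X ⟶ X}, 𝟙 X = c → BimoduleIso (idBimodule (fib X)) (bmod c)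

attribute [instance] MapPrePseudofunctor.cat

namespace MapPrePseudofunctor

variable {k : Type w} [CommRing k] {C : Type u} [SmallCategory C] (P : MapPrePseudofunctor k C)

/-- The set `S_c(U, V)`. -/
abbrev S {X Y : C} (c : X ⟶ Y) (U : P.base X) (V : P.base Y) : Type u := (P.bfun c).obj (op U, V)

/-- The map `S_d(V, W) × S_c(U, V) → S_{d c}(U, W)` induced by the composition isomorphism. -/
def mulBase {X Y Z : C} {c : X ⟶ Y} {d : Y ⟶ Z} {e : X ⟶ Z} (h : c ≫ d = e) {U : P.base X}
    {V : P.base Y} {W : P.base Z} (t : P.S d V W) (s : P.S c U V) : P.S e U W :=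
  (P.mapComp h).base.hom.app (op U, W) ((P.bfun d).pair (P.bfun c) t s)

/-- The map `M_d ⊗ M_c → M_{d c}` induced by the composition isomorphism. -/
noncomputable def mul {X Y Z : C} {c : X ⟶ Y} {d : Y ⟶ Z} {e : X ⟶ Z} (h : c ≫ d = e)
    {U : P.base X} {V : P.base Y} {W : P.base Z} {t : P.S d V W} {s : P.S c U V} {r : P.S e U W}
    (hr : P.mulBase h t s = r) {A : (P.fib X).Obj U} {B : (P.fib Y).Obj V} {D : (P.fib Z).Obj W} :
    (P.bmod d).Elt t B D →ₗ[k] (P.bmod c).Elt s A B →ₗ[k] (P.bmod e).Elt r A D :=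
  (tensorMk (P.bmod d) (P.bmod c) rfl).compr₂
    (((P.bmod e).reindex hr A D).toLinearMap ∘ₗ ((P.mapComp h).fib _ A D).toLinearMap)

/-- The map `U_X(U, V) → S_1(U, V)` given by the unit isomorphism. -/
def oneBase {X : C} {c : X ⟶ X} (h : 𝟙 X = c) {U V : P.base X} (f : U ⟶ V) : P.S c U V :=
  (P.mapId h).base.hom.app (op U, V) f

/-- The map `a_X(A, B) → M_1(A, B)` given by the unit isomorphism. -/
def one {X : C} {c : X ⟶ X} (h : 𝟙 X = c) {U V : P.base X} {f : U ⟶ V} {s : P.S c U V}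
    (hs : P.oneBase h f = s) {A : (P.fib X).Obj U} {B : (P.fib X).Obj V}
    (x : (P.fib X).Hom f A B) : (P.bmod c).Elt s A B :=
  (P.bmod c).reindex hs A B ((P.mapId h).fib (X := U) (Y := V) f A B x)

end MapPrePseudofunctor

/-- A pseudofunctor from `C` to the bicategory of map-graded categories: the data above with the
associativity and unit coherence axioms.  As the classes `(t, s)` and `y ⊗ x` generate the composed
bimodules, coherence is expressed on them.  The fields come in pairs, for the elements of the `S_c`
and of the `M_c`: associativity `r(ts) = (rt)s`, and the unit axioms, saying that multiplication by
the image of a morphism of `U_X` (of an element of `a_X`) under the unit isomorphism is the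
corresponding action on the bimodule. -/
structure MapPseudofunctor (k : Type w) [CommRing k] (C : Type u) [SmallCategory C] extends
    MapPrePseudofunctor k C where
  mulBase_assoc : ∀ {X₀ X₁ X₂ X₃ : C} {c : X₀ ⟶ X₁} {d : X₁ ⟶ X₂} {e : X₂ ⟶ X₃} {cd : X₀ ⟶ X₂}
    {de : X₁ ⟶ X₃} {cde : X₀ ⟶ X₃} (h₁ : c ≫ d = cd) (h₂ : d ≫ e = de) (h₃ : cd ≫ e = cde)
    (h₄ : c ≫ de = cde) {U₀ : base X₀} {U₁ : base X₁} {U₂ : base X₂} {U₃ : base X₃}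
    (r : toMapPrePseudofunctor.S e U₂ U₃) (t : toMapPrePseudofunctor.S d U₁ U₂)
    (s : toMapPrePseudofunctor.S c U₀ U₁),
    toMapPrePseudofunctor.mulBase h₃ r (toMapPrePseudofunctor.mulBase h₁ t s) =
      toMapPrePseudofunctor.mulBase h₄ (toMapPrePseudofunctor.mulBase h₂ r t) s
  mul_assoc : ∀ {X₀ X₁ X₂ X₃ : C} {c : X₀ ⟶ X₁} {d : X₁ ⟶ X₂} {e : X₂ ⟶ X₃} {cd : X₀ ⟶ X₂}
    {de : X₁ ⟶ X₃} {cde : X₀ ⟶ X₃} (h₁ : c ≫ d = cd) (h₂ : d ≫ e = de) (h₃ : cd ≫ e = cde)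
    (h₄ : c ≫ de = cde) {U₀ : base X₀} {U₁ : base X₁} {U₂ : base X₂} {U₃ : base X₃}
    {r : toMapPrePseudofunctor.S e U₂ U₃} {t : toMapPrePseudofunctor.S d U₁ U₂}
    {s : toMapPrePseudofunctor.S c U₀ U₁} {ts : toMapPrePseudofunctor.S cd U₀ U₂}
    {rt : toMapPrePseudofunctor.S de U₁ U₃} {rts : toMapPrePseudofunctor.S cde U₀ U₃}
    (e₁ : toMapPrePseudofunctor.mulBase h₁ t s = ts)
    (e₂ : toMapPrePseudofunctor.mulBase h₂ r t = rt)
    (e₃ : toMapPrePseudofunctor.mulBase h₃ r ts = rts)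
    (e₄ : toMapPrePseudofunctor.mulBase h₄ rt s = rts)
    {A₀ : (fib X₀).Obj U₀} {A₁ : (fib X₁).Obj U₁} {A₂ : (fib X₂).Obj U₂} {A₃ : (fib X₃).Obj U₃}
    (z : (bmod e).Elt r A₂ A₃) (y : (bmod d).Elt t A₁ A₂) (x : (bmod c).Elt s A₀ A₁),
    toMapPrePseudofunctor.mul h₃ e₃ z (toMapPrePseudofunctor.mul h₁ e₁ y x) =
      toMapPrePseudofunctor.mul h₄ e₄ (toMapPrePseudofunctor.mul h₂ e₂ z y) x
  mulBase_one : ∀ {X Y : C} {i : X ⟶ X} {c : X ⟶ Y} (hi : 𝟙 X = i) (h : i ≫ c = c)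
    {U U' : base X} {V : base Y} (s : toMapPrePseudofunctor.S c U V) (f : U' ⟶ U),
    toMapPrePseudofunctor.mulBase h s (toMapPrePseudofunctor.oneBase hi f) =
      (bfun c).act (𝟙 V) s f
  mul_one : ∀ {X Y : C} {i : X ⟶ X} {c : X ⟶ Y} (hi : 𝟙 X = i) (h : i ≫ c = c)
    {U U' : base X} {V : base Y} {s : toMapPrePseudofunctor.S c U V} {f : U' ⟶ U}
    {f' : toMapPrePseudofunctor.S i U' U} {s' : toMapPrePseudofunctor.S c U' V}
    (e₁ : toMapPrePseudofunctor.oneBase hi f = f')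
    (e₂ : toMapPrePseudofunctor.mulBase h s f' = s') (e₃ : (bfun c).act (𝟙 V) s f = s')
    {A : (fib X).Obj U} {A' : (fib X).Obj U'} {B : (fib Y).Obj V}
    (m : (bmod c).Elt s A B) (x : (fib X).Hom f A' A),
    toMapPrePseudofunctor.mul h e₂ m (toMapPrePseudofunctor.one hi e₁ x) =
      (bmod c).act e₃ ((fib Y).id B) m x
  one_mulBase : ∀ {X Y : C} {i : Y ⟶ Y} {c : X ⟶ Y} (hi : 𝟙 Y = i) (h : c ≫ i = c)
    {U : base X} {V V' : base Y} (g : V ⟶ V') (s : toMapPrePseudofunctor.S c U V),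
    toMapPrePseudofunctor.mulBase h (toMapPrePseudofunctor.oneBase hi g) s =
      (bfun c).act g s (𝟙 U)
  one_mul : ∀ {X Y : C} {i : Y ⟶ Y} {c : X ⟶ Y} (hi : 𝟙 Y = i) (h : c ≫ i = c)
    {U : base X} {V V' : base Y} {g : V ⟶ V'} {s : toMapPrePseudofunctor.S c U V}
    {g' : toMapPrePseudofunctor.S i V V'} {s' : toMapPrePseudofunctor.S c U V'}
    (e₁ : toMapPrePseudofunctor.oneBase hi g = g')
    (e₂ : toMapPrePseudofunctor.mulBase h g' s = s') (e₃ : (bfun c).act g s (𝟙 U) = s')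
    {A : (fib X).Obj U} {B : (fib Y).Obj V} {B' : (fib Y).Obj V'}
    (y : (fib Y).Hom g B B') (m : (bmod c).Elt s A B),
    toMapPrePseudofunctor.mul h e₂ (toMapPrePseudofunctor.one hi e₁ y) m =
      (bmod c).act e₃ y m ((fib X).id A)

namespace MapPseudofunctor

variable {k : Type w} [CommRing k] {C : Type u} [SmallCategory C]

/-- The objects of the (non-linear) Grothendieck construction: pairs of `X` in `C` and an object of `U_X`. -/
structure Groth (P : MapPseudofunctor k C) : Type u where
  pt : C
  ob : P.base pt

variable (P : MapPseudofunctor k C)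

/-- Morphisms of the Grothendieck construction: pairs of `c` in `C` and an element of `S_c`. -/
@[ext]
structure GrothHom (X Y : Groth P) : Type u where
  arr : X.pt ⟶ Y.pt
  elt : P.S arr X.ob Y.ob

variable {P}

theorem GrothHom.mk_eq {X Y Z : Groth P} (s : GrothHom P X Y) (t : GrothHom P Y Z)
    {e : X.pt ⟶ Z.pt} (h : s.arr ≫ t.arr = e) :
    (⟨s.arr ≫ t.arr, P.mulBase rfl t.elt s.elt⟩ : GrothHom P X Z) =
      ⟨e, P.mulBase h t.elt s.elt⟩ := by
  subst h
  rfl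

instance (P : MapPseudofunctor k C) : SmallCategory (Groth P) where
  Hom X Y := GrothHom P X Y
  id X := ⟨𝟙 X.pt, P.oneBase rfl (𝟙 X.ob)⟩
  comp s t := ⟨s.arr ≫ t.arr, P.mulBase rfl t.elt s.elt⟩
  id_comp {X Y} s := by
    refine (GrothHom.mk_eq (⟨𝟙 X.pt, P.oneBase rfl (𝟙 X.ob)⟩ : GrothHom P X X) s
      (Category.id_comp s.arr)).trans ?_
    simp only [P.mulBase_one, Bifunctor.act_id]
  comp_id {X Y} s := by
    refine (GrothHom.mk_eq s (⟨𝟙 Y.pt, P.oneBase rfl (𝟙 Y.ob)⟩ : GrothHom P Y Y)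
      (Category.comp_id s.arr)).trans ?_
    simp only [P.one_mulBase, Bifunctor.act_id]
  assoc {X Y Z W} s t r := by
    refine (GrothHom.mk_eq (⟨s.arr ≫ t.arr, P.mulBase rfl t.elt s.elt⟩ : GrothHom P X Z) r
      (Category.assoc s.arr t.arr r.arr)).trans ?_
    rw [P.mulBase_assoc rfl rfl _ rfl]

theorem Groth.arr_comp {X Y Z : Groth P} {f : X ⟶ Y} {g : Y ⟶ Z} {h : X ⟶ Z} (e : f ≫ g = h) :
    f.arr ≫ g.arr = h.arr := congrArg GrothHom.arr e

theorem Groth.elt_comp {X Y Z : Groth P} {f : X ⟶ Y} {g : Y ⟶ Z} {h : X ⟶ Z} (e : f ≫ g = h) :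
    P.mulBase (Groth.arr_comp e) g.elt f.elt = h.elt := by
  subst e
  rfl

/-- The Grothendieck construction `(Ũ, ã)` of `P`: `ã_{(c, s)}(A, B) = M_{c, s}(A, B)`. -/
noncomputable def grothCat (P : MapPseudofunctor k C) : GradedCat k (Groth P) where
  Obj X := (P.fib X.pt).Obj X.ob
  Hom f A B := (P.bmod f.arr).Elt f.elt A B
  id {X} A := P.one rfl rfl ((P.fib X.pt).id A)
  comp {X Y Z f g h} e {A B D} := P.mul (Groth.arr_comp e) (Groth.elt_comp e)
  comp_id {X Y f} e {A B} x :=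
    (P.mul_one rfl (Groth.arr_comp e) rfl (Groth.elt_comp e) (Bifunctor.act_id _ _) x _).trans
      ((P.bmod f.arr).act_id _ x)
  id_comp {X Y f} e {A B} x :=
    (P.one_mul rfl (Groth.arr_comp e) rfl (Groth.elt_comp e) (Bifunctor.act_id _ _) _ x).trans
      ((P.bmod f.arr).act_id _ x)
  assoc {X Y Z W f g h fg gh fgh} e₁ e₂ e₃ e₄ {A B D E} z y x :=
    P.mul_assoc (Groth.arr_comp e₁) (Groth.arr_comp e₂) (Groth.arr_comp e₃) (Groth.arr_comp e₄)
      (Groth.elt_comp e₁) (Groth.elt_comp e₂) (Groth.elt_comp e₃) (Groth.elt_comp e₄) z y x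

/-- The restriction of a pseudofunctor along a functor `Φ : D ⥤ C`. -/
def precomp {D : Type u} [SmallCategory D] (P : MapPseudofunctor k C) (Φ : D ⥤ C) :
    MapPseudofunctor k D where
  base X := P.base (Φ.obj X)
  cat X := P.cat (Φ.obj X)
  fib X := P.fib (Φ.obj X)
  bfun c := P.bfun (Φ.map c)
  bmod c := P.bmod (Φ.map c)
  mapComp h := P.mapComp ((Φ.map_comp _ _).symm.trans (congrArg Φ.map h))
  mapId h := P.mapId ((Φ.map_id _).symm.trans (congrArg Φ.map h))
  mulBase_assoc h₁ h₂ h₃ h₄ _ _ _ _ r t s :=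
    P.mulBase_assoc ((Φ.map_comp _ _).symm.trans (congrArg Φ.map h₁))
      ((Φ.map_comp _ _).symm.trans (congrArg Φ.map h₂))
      ((Φ.map_comp _ _).symm.trans (congrArg Φ.map h₃))
      ((Φ.map_comp _ _).symm.trans (congrArg Φ.map h₄)) r t s
  mul_assoc h₁ h₂ h₃ h₄ _ _ _ _ _ _ _ _ _ _ e₁ e₂ e₃ e₄ _ _ _ _ z y x :=
    P.mul_assoc ((Φ.map_comp _ _).symm.trans (congrArg Φ.map h₁))
      ((Φ.map_comp _ _).symm.trans (congrArg Φ.map h₂))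
      ((Φ.map_comp _ _).symm.trans (congrArg Φ.map h₃))
      ((Φ.map_comp _ _).symm.trans (congrArg Φ.map h₄)) e₁ e₂ e₃ e₄ z y x
  mulBase_one hi h _ _ _ s f :=
    P.mulBase_one ((Φ.map_id _).symm.trans (congrArg Φ.map hi))
      ((Φ.map_comp _ _).symm.trans (congrArg Φ.map h)) s f
  mul_one hi h _ _ _ _ _ _ _ e₁ e₂ e₃ _ _ _ m x :=
    P.mul_one ((Φ.map_id _).symm.trans (congrArg Φ.map hi))
      ((Φ.map_comp _ _).symm.trans (congrArg Φ.map h)) e₁ e₂ e₃ m x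
  one_mulBase hi h _ _ _ g s :=
    P.one_mulBase ((Φ.map_id _).symm.trans (congrArg Φ.map hi))
      ((Φ.map_comp _ _).symm.trans (congrArg Φ.map h)) g s
  one_mul hi h _ _ _ _ _ _ _ e₁ e₂ e₃ _ _ _ y m :=
    P.one_mul ((Φ.map_id _).symm.trans (congrArg Φ.map hi))
      ((Φ.map_comp _ _).symm.trans (congrArg Φ.map h)) e₁ e₂ e₃ y m

end MapPseudofunctor

/-- Transport of elements of a graded category along an equality of indices. -/
def GradedCat.reindex {k : Type w} [CommRing k] {U : Type u} [SmallCategory U] (a : GradedCat k U)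
    {X Y : U} {f g : X ⟶ Y} (e : f = g) (A : a.Obj X) (B : a.Obj Y) :
    a.Hom f A B ≃ₗ[k] a.Hom g A B :=
  e ▸ LinearEquiv.refl k (a.Hom f A B)

/-- A graded functor `(φ, F) : (V, b) → (U, a)` of map-graded categories. -/
structure GradedFunctor {k : Type w} [CommRing k] {V U : Type u} [SmallCategory V]
    [SmallCategory U] (b : GradedCat k V) (a : GradedCat k U) where
  base : V ⥤ U
  obj : ∀ {X : V}, b.Obj X → a.Obj (base.obj X)
  map : ∀ {X Y : V} (f : X ⟶ Y) (B : b.Obj X) (B' : b.Obj Y),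
    b.Hom f B B' →ₗ[k] a.Hom (base.map f) (obj B) (obj B')
  map_id : ∀ {X : V} (B : b.Obj X),
    map (𝟙 X) B B (b.id B) = a.reindex (base.map_id X).symm _ _ (a.id (obj B))
  map_comp : ∀ {X Y Z : V} {f : X ⟶ Y} {g : Y ⟶ Z} {h : X ⟶ Z} (e : f ≫ g = h)
    (e' : base.map f ≫ base.map g = base.map h) {B : b.Obj X} {B' : b.Obj Y} {B'' : b.Obj Z}
    (y : b.Hom g B' B'') (x : b.Hom f B B'),
    map h B B'' (b.comp e y x) = a.comp e' (map g B' B'' y) (map f B B' x)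

/-- A graded functor is subcartesian if all its maps `b_f(B, B') → a_{φ(f)}(F B, F B')` are isomorphisms. -/
def GradedFunctor.IsSubcartesian {k : Type w} [CommRing k] {V U : Type u} [SmallCategory V]
    [SmallCategory U] {b : GradedCat k V} {a : GradedCat k U} (F : GradedFunctor b a) : Prop :=
  ∀ {X Y : V} (f : X ⟶ Y) (B : b.Obj X) (B' : b.Obj Y), Function.Bijective (F.map f B B')

theorem GradedFunctor.map_reindex {k : Type w} [CommRing k] {V U : Type u} [SmallCategory V]
    [SmallCategory U] {b : GradedCat k V} {a : GradedCat k U} (F : GradedFunctor b a) {X Y : V}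
    {f g : X ⟶ Y} (e : f = g) (A : b.Obj X) (B : b.Obj Y) (x : b.Hom f A B) :
    F.map g A B (b.reindex e A B x) =
      a.reindex (congrArg F.base.map e) _ _ (F.map f A B x) := by
  subst e
  rfl

/-- Map-graded categories; the morphisms of the category below are the subcartesian graded functors. -/
structure MapSc (k : Type w) [CommRing k] where
  base : Type u
  [cat : SmallCategory base]
  fib : GradedCat k base

attribute [instance] MapSc.cat

namespace MapSc

variable {k : Type w} [CommRing k]

theorem reindex_trans {U : Type u} [SmallCategory U] (a : GradedCat k U)
    {X Y : U} {f g h : X ⟶ Y} (e : f = g) (e' : g = h) (A : a.Obj X) (B : a.Obj Y)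
    (x : a.Hom f A B) : a.reindex e' A B (a.reindex e A B x) = a.reindex (e.trans e') A B x := by
  subst e e'
  rfl

structure Hom (X Y : MapSc.{w, u} k) where
  toFun : GradedFunctor X.fib Y.fib
  sub : toFun.IsSubcartesian

def idHom (X : MapSc.{w, u} k) : Hom X X where
  toFun :=
    { base := 𝟭 X.base
      obj := fun A => A
      map := fun f A B => LinearMap.id
      map_id := fun B => rfl
      map_comp := fun e e' B B' B'' y x => rfl }
  sub f A B := Function.bijective_id

def compHom {X Y Z : MapSc.{w, u} k} (F : Hom X Y) (G : Hom Y Z) : Hom X Z where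
  toFun :=
    { base := F.toFun.base ⋙ G.toFun.base
      obj := fun A => G.toFun.obj (F.toFun.obj A)
      map := fun f A B => (G.toFun.map _ _ _).comp (F.toFun.map f A B)
      map_id := fun {V} B => by
        rw [LinearMap.comp_apply, F.toFun.map_id, G.toFun.map_reindex, G.toFun.map_id,
          reindex_trans]
      map_comp := fun {_ _ _ f g h} e e' {_ _ _} y x => by
        simp only [LinearMap.comp_apply]
        rw [F.toFun.map_comp e (by rw [← e, F.toFun.base.map_comp]),
          G.toFun.map_comp _ e'] }
  sub f A B := (G.sub _ _ _).comp (F.sub f A B)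

instance : Category (MapSc.{w, u} k) where
  Hom := Hom
  id := idHom
  comp := compHom

end MapSc

namespace MapPseudofunctor

variable {k : Type w} [CommRing k] {C : Type u} [SmallCategory C]

theorem GrothHom.mk_oneBase {P : MapPseudofunctor k C} {X : Groth P} {c : X.pt ⟶ X.pt}
    (h : 𝟙 X.pt = c) : (⟨c, P.oneBase h (𝟙 X.ob)⟩ : GrothHom P X X) =
      ⟨𝟙 X.pt, P.oneBase rfl (𝟙 X.ob)⟩ := by
  subst h
  rfl

theorem grothCat_one {P : MapPseudofunctor k C} {X : Groth P} {c : X.pt ⟶ X.pt}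
    (h : 𝟙 X.pt = c) (A : (P.fib X.pt).Obj X.ob)
    (e : 𝟙 X = (⟨c, P.oneBase h (𝟙 X.ob)⟩ : GrothHom P X X)) :
    P.one h rfl ((P.fib X.pt).id A) = P.grothCat.reindex e A A (P.grothCat.id A) := by
  subst h
  rfl

/-- The functor between Grothendieck constructions induced by `Φ : D ⥤ C`. -/
def baseFunctor (P : MapPseudofunctor k C) {D : Type u} [SmallCategory D] (Φ : D ⥤ C) :
    Groth (P.precomp Φ) ⥤ Groth P where
  obj X := ⟨Φ.obj X.pt, X.ob⟩
  map {X Y} f := (⟨Φ.map f.arr, f.elt⟩ : GrothHom P ⟨Φ.obj X.pt, X.ob⟩ ⟨Φ.obj Y.pt, Y.ob⟩)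
  map_id X := GrothHom.mk_oneBase (P := P) (X := ⟨Φ.obj X.pt, X.ob⟩) (Φ.map_id _).symm
  map_comp {X Y Z} f g := by
    symm
    exact GrothHom.mk_eq (P := P) (X := ⟨Φ.obj X.pt, X.ob⟩) (Y := ⟨Φ.obj Y.pt, Y.ob⟩)
      (Z := ⟨Φ.obj Z.pt, Z.ob⟩) ⟨Φ.map f.arr, f.elt⟩ ⟨Φ.map g.arr, g.elt⟩ (Φ.map_comp _ _).symm

/-- The Grothendieck construction as a map-graded category. -/
noncomputable def groth (P : MapPseudofunctor k C) : MapSc.{w, u} k := ⟨Groth P, grothCat P⟩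

/-- The subcartesian graded functor from the Grothendieck construction of the restriction of `P` along `Φ`. -/
noncomputable def baseChange (P : MapPseudofunctor k C) {D : Type u} [SmallCategory D]
    (Φ : D ⥤ C) : (P.precomp Φ).groth ⟶ P.groth where
  toFun :=
    { base := P.baseFunctor Φ
      obj := fun A => A
      map := fun f A B => LinearMap.id
      map_id := fun {X} B => grothCat_one (P := P) (X := ⟨Φ.obj X.pt, X.ob⟩) (Φ.map_id _).symm B _
      map_comp := fun {X Y Z f g h} e e' {_ _ _} y x => rfl }
  sub f A B := Function.bijective_id

section Star

variable {D : Type u} [SmallCategory D]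

/-- The functor `baseChange`, with its source replaced by an equal one (used for functoriality only). -/
noncomputable def bc (Q : MapPseudofunctor k C) {R : MapPseudofunctor k D} (Ψ : D ⥤ C)
    (h : Q.precomp Ψ = R) : R.groth ⟶ Q.groth := by
  subst h
  exact Q.baseChange Ψ

theorem bc_congr (Q : MapPseudofunctor k C) {R : MapPseudofunctor k D} {Ψ Ψ' : D ⥤ C}
    (e : Ψ = Ψ') (h : Q.precomp Ψ = R) (h' : Q.precomp Ψ' = R) : Q.bc Ψ h = Q.bc Ψ' h' := by
  subst e
  rfl

/-- The functor from `C` with a terminal object `∗` adjoined to map-graded categories and subcartesian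
functors: an object `X` of `C` goes to the Grothendieck construction of the restriction of `P` along
`C/X ⥤ C`, and `∗` goes to the Grothendieck construction of `P` itself. -/
noncomputable def starFunctor (P : MapPseudofunctor k C) : WithTerminal C ⥤ MapSc.{w, u} k :=
  WithTerminal.lift
    { obj := fun X => (P.precomp (Over.forget X)).groth
      map := fun {X Y} c => (P.precomp (Over.forget Y)).baseChange (Over.map c)
      map_id := fun X => by
        exact bc_congr (P.precomp (Over.forget X)) (R := P.precomp (Over.forget X))
          (Over.mapId_eq X) rfl rfl
      map_comp := fun {X Y Z} c d => by
        exact bc_congr (P.precomp (Over.forget Z)) (R := P.precomp (Over.forget X))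
          (Over.mapComp_eq c d) rfl rfl }
    (fun X => P.baseChange (Over.forget X))
    (fun X Y c => rfl)

end Star

end MapPseudofunctor

section Hochschild

/-- The category `U^♯`: objects are pairs of an object `X` of `U` and an object of `a` over `X`,
morphisms are those of `U`.  Its nerve indexes the Hochschild complex. -/
structure GradedCat.Sharp {k : Type w} [CommRing k] {U : Type u} [SmallCategory U]
    (a : GradedCat k U) : Type u where
  base : U
  obj : a.Obj base

instance {k : Type w} [CommRing k] {U : Type u} [SmallCategory U] (a : GradedCat k U) :
    SmallCategory a.Sharp where
  Hom X Y := X.base ⟶ Y.base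
  id X := 𝟙 X.base
  comp f g := f ≫ g

variable {k : Type w} [CommRing k] {U : Type u} [SmallCategory U] {a : GradedCat k U}

section Segments

variable {n : ℕ} (σ : ComposableArrows a.Sharp n)

/-- The module `a_u(A_i, A_j)`, for a simplex `σ` of `U^♯` and `u` the composite of its arrows from `i` to `j`. -/
abbrev seg {i j : Fin (n + 1)} (h : i ≤ j) : Type u :=
  a.Hom (X := (σ.obj i).base) (Y := (σ.obj j).base) (σ.map (homOfLE h)) (σ.obj i).obj (σ.obj j).obj

/-- Composition `a(A_j, A_l) ⊗ a(A_i, A_j) → a(A_i, A_l)` along a simplex. -/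
def segComp {i j l : Fin (n + 1)} (h : i ≤ j) (h' : j ≤ l) :
    seg σ h' →ₗ[k] seg σ h →ₗ[k] seg σ (h.trans h') :=
  a.comp (σ.map_comp (homOfLE h) (homOfLE h')).symm

/-- The identity of `A_i`. -/
def segId (i : Fin (n + 1)) : seg σ (le_refl i) :=
  a.reindex (σ.map_id i).symm _ _ (a.id (σ.obj i).obj)

theorem GradedCat.comp_reindex_id {X Y : U} {f : X ⟶ Y} {i : X ⟶ X} (hi : 𝟙 X = i)
    (e : i ≫ f = f) {A : a.Obj X} {B : a.Obj Y} (x : a.Hom f A B) :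
    a.comp e x (a.reindex hi A A (a.id A)) = x := by
  subst hi
  exact a.comp_id e x

theorem GradedCat.reindex_id_comp {X Y : U} {f : X ⟶ Y} {i : Y ⟶ Y} (hi : 𝟙 Y = i)
    (e : f ≫ i = f) {A : a.Obj X} {B : a.Obj Y} (x : a.Hom f A B) :
    a.comp e (a.reindex hi B B (a.id B)) x = x := by
  subst hi
  exact a.id_comp e x

theorem segComp_segId {i j : Fin (n + 1)} (h : i ≤ j) (x : seg σ h) :
    segComp σ (le_refl i) h x (segId σ i) = x :=
  a.comp_reindex_id _ _ _

theorem segId_segComp {i j : Fin (n + 1)} (h : i ≤ j) (x : seg σ h) :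
    segComp σ h (le_refl j) (segId σ j) x = x :=
  a.reindex_id_comp _ _ _

theorem segComp_assoc {i j l m : Fin (n + 1)} (h : i ≤ j) (h' : j ≤ l) (h'' : l ≤ m)
    (z : seg σ h'') (y : seg σ h') (x : seg σ h) :
    segComp σ (h.trans h') h'' z (segComp σ h h' y x) =
      segComp σ h (h'.trans h'') (segComp σ h' h'' z y) x :=
  a.assoc _ _ _ _ z y x

/-- Elements `f_0, …, f_{n-1}`, with `f_i` in `a(A_i, A_{i+1})`, over a simplex. -/
abbrev Chain : Type u := ∀ i : Fin n, seg σ i.castSucc_lt_succ.le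

variable {σ}

/-- The composite `f_{q-1} ∘ ⋯ ∘ f_p`. -/
def compSeg (f : Chain σ) {p : Fin (n + 1)} : ∀ {q : Fin (n + 1)} (h : p ≤ q), seg σ h :=
  fun {q} => Fin.induction (motive := fun q => ∀ h : p ≤ q, seg σ h)
    (fun h => by
      obtain rfl : p = 0 := le_antisymm h (Fin.zero_le p)
      exact segId σ 0)
    (fun j ih h =>
      if hp : p ≤ j.castSucc then segComp σ hp j.castSucc_lt_succ.le (f j) (ih hp)
      else by
        obtain rfl : p = j.succ := le_antisymm h (Fin.castSucc_lt_iff_succ_le.1 (not_le.1 hp))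
        exact segId σ j.succ) q

theorem compSeg_self (f : Chain σ) (p : Fin (n + 1)) : compSeg f (le_refl p) = segId σ p := by
  induction p using Fin.cases with
  | zero => rfl
  | succ j => simp [compSeg]

theorem compSeg_succ (f : Chain σ) {p : Fin (n + 1)} (j : Fin n) (hp : p ≤ j.castSucc)
    (h : p ≤ j.succ) :
    compSeg f h = segComp σ hp j.castSucc_lt_succ.le (f j) (compSeg f hp) := by
  simp [compSeg, hp]

theorem compSeg_trans (f : Chain σ) {p q r : Fin (n + 1)} (h : p ≤ q) (h' : q ≤ r) :
    segComp σ h h' (compSeg f h') (compSeg f h) = compSeg f (h.trans h') := by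
  induction r using Fin.induction with
  | zero =>
    obtain rfl : q = 0 := le_antisymm h' (Fin.zero_le q)
    rw [compSeg_self, segId_segComp]
  | succ j ih =>
    by_cases hq : q ≤ j.castSucc
    · rw [compSeg_succ f j hq h', compSeg_succ f j (h.trans hq), ← ih hq, segComp_assoc]
    · obtain rfl : q = j.succ := le_antisymm h' (Fin.castSucc_lt_iff_succ_le.1 (not_le.1 hq))
      rw [compSeg_self, segId_segComp]

theorem compSeg_one (f : Chain σ) (j : Fin n) : compSeg f j.castSucc_lt_succ.le = f j := by
  rw [compSeg_succ f j (le_refl _), compSeg_self, segComp_segId]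

/-- The simplex obtained by applying a monotone map to `σ`. -/
def restrictSimplex {m : ℕ} (θ : Fin (m + 1) →o Fin (n + 1)) (σ : ComposableArrows a.Sharp n) :
    ComposableArrows a.Sharp m := θ.monotone.functor ⋙ σ

/-- The elements obtained from `f` by composition (and insertion of identities) along a monotone map. -/
def restrictChain {m : ℕ} (θ : Fin (m + 1) →o Fin (n + 1)) (f : Chain σ) :
    Chain (restrictSimplex θ σ) :=
  fun j => compSeg f (θ.monotone j.castSucc_lt_succ.le)

theorem compSeg_restrictChain {m : ℕ} (θ : Fin (m + 1) →o Fin (n + 1)) (f : Chain σ)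
    {p q : Fin (m + 1)} (h : p ≤ q) :
    (compSeg (restrictChain θ f) h : seg σ (θ.monotone h)) = compSeg f (θ.monotone h) := by
  induction q using Fin.induction with
  | zero =>
    obtain rfl : p = 0 := le_antisymm h (Fin.zero_le p)
    rw [compSeg_self, compSeg_self]
    rfl
  | succ j ih =>
    by_cases hp : p ≤ j.castSucc
    · rw [compSeg_succ _ j hp h, ih hp,
        ← compSeg_trans f (θ.monotone hp) (θ.monotone j.castSucc_lt_succ.le)]
      rfl
    · obtain rfl : p = j.succ := le_antisymm h (Fin.castSucc_lt_iff_succ_le.1 (not_le.1 hp))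
      rw [compSeg_self, compSeg_self]
      rfl

end Segments

section Multilinear

variable {ι : Type*} [DecidableEq ι] {M : ι → Type*} [∀ i, AddCommGroup (M i)]
  [∀ i, Module k (M i)] {N N' N'' : Type*} [AddCommGroup N] [Module k N] [AddCommGroup N']
  [Module k N'] [AddCommGroup N''] [Module k N'']

/-- `T` does not depend on the coordinates outside `s` and is linear in each coordinate in `s`. -/
structure MultilinearOn (k : Type w) [CommRing k] [∀ i, Module k (M i)] [Module k N] (s : Set ι)
    (T : (∀ i, M i) → N) : Prop where
  outside : ∀ f l v, l ∉ s → T (Function.update f l v) = T f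
  add : ∀ f l v v', l ∈ s → T (Function.update f l (v + v')) =
    T (Function.update f l v) + T (Function.update f l v')
  smul : ∀ f l (c : k) v, l ∈ s → T (Function.update f l (c • v)) = c • T (Function.update f l v)

theorem MultilinearOn.const (c : N) : MultilinearOn k ∅ (fun _ : (∀ i, M i) => c) :=
  ⟨fun _ _ _ _ => rfl, fun _ _ _ _ h => h.elim, fun _ _ _ _ h => h.elim⟩

theorem MultilinearOn.eval (i : ι) : MultilinearOn k {i} (fun f : (∀ i, M i) => f i) where
  outside f l v h := by
    rw [Function.update_of_ne]
    rintro rfl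
    exact h rfl
  add f l v v' h := by
    obtain rfl : l = i := h
    simp
  smul f l c v h := by
    obtain rfl : l = i := h
    simp

theorem MultilinearOn.bilin {s s' : Set ι} {T : (∀ i, M i) → N} {T' : (∀ i, M i) → N'}
    (hT : MultilinearOn k s T) (hT' : MultilinearOn k s' T') (h : Disjoint s s')
    (B : N →ₗ[k] N' →ₗ[k] N'') : MultilinearOn k (s ∪ s') (fun f => B (T f) (T' f)) where
  outside f l v hl := by
    rw [hT.outside f l v fun h => hl (Or.inl h), hT'.outside f l v fun h => hl (Or.inr h)]
  add f l v v' hl := by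
    by_cases hs : l ∈ s
    · have hs' := Set.disjoint_left.1 h hs
      simp only [hT'.outside _ _ _ hs', hT.add _ _ _ _ hs, map_add, LinearMap.add_apply]
    · have hs' := hl.resolve_left hs
      simp only [hT.outside _ _ _ hs, hT'.add _ _ _ _ hs', map_add]
  smul f l c v hl := by
    by_cases hs : l ∈ s
    · have hs' := Set.disjoint_left.1 h hs
      simp only [hT'.outside _ _ _ hs', hT.smul _ _ _ _ hs, map_smul, LinearMap.smul_apply]
    · have hs' := hl.resolve_left hs
      simp only [hT.outside _ _ _ hs, hT'.smul _ _ _ _ hs', map_smul]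

theorem MultilinearOn.comp {κ : Type*} [DecidableEq κ] {M' : κ → Type*}
    [∀ i, AddCommGroup (M' i)] [∀ i, Module k (M' i)] (φ : MultilinearMap k M' N) {s : κ → Set ι}
    {T : ∀ j, (∀ i, M i) → M' j} (hT : ∀ j, MultilinearOn k (s j) (T j))
    (h : ∀ j j', j ≠ j' → Disjoint (s j) (s j')) :
    MultilinearOn k (⋃ j, s j) (fun f => φ (fun j => T j f)) := by
  have key : ∀ f l v j, l ∈ s j → (fun j' => T j' (Function.update f l v)) =
      Function.update (fun j' => T j' f) j (T j (Function.update f l v)) := by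
    intro f l v j hl
    funext j'
    by_cases e : j' = j
    · subst e
      simp
    · rw [Function.update_of_ne e,
        (hT j').outside _ _ _ (Set.disjoint_left.1 (h j j' (Ne.symm e)) hl)]
  refine ⟨fun f l v hl => ?_, fun f l v v' hl => ?_, fun f l c v hl => ?_⟩
  · congr 1
    funext j
    exact (hT j).outside _ _ _ fun h => hl (Set.mem_iUnion.2 ⟨j, h⟩)
  · obtain ⟨j, hj⟩ := Set.mem_iUnion.1 hl
    rw [key _ _ _ j hj, key _ _ v j hj, key _ _ v' j hj, (hT j).add _ _ _ _ hj, φ.map_update_add]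
  · obtain ⟨j, hj⟩ := Set.mem_iUnion.1 hl
    rw [key _ _ _ j hj, key _ _ v j hj, (hT j).smul _ _ _ _ hj, φ.map_update_smul]

theorem MultilinearOn.congr {s s' : Set ι} {T : (∀ i, M i) → N} (hT : MultilinearOn k s T)
    (h : s = s') : MultilinearOn k s' T := h ▸ hT

/-- A map which is linear in all coordinates, as a multilinear map. -/
def MultilinearOn.toMultilinearMap {T : (∀ i, M i) → N} (hT : MultilinearOn k Set.univ T) :
    MultilinearMap k M N :=
  MultilinearMap.mk' T (fun f l v v' => hT.add f l v v' trivial)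
    (fun f l c v => hT.smul f l c v trivial)

end Multilinear

section Cochains

variable {n : ℕ} {σ : ComposableArrows a.Sharp n}

/-- The arrows of a simplex between the vertices `p` and `q`. -/
def arrowsBetween (p q : Fin (n + 1)) : Set (Fin n) := {l | p ≤ l.castSucc ∧ l.castSucc < q}

theorem arrowsBetween_disjoint {p q p' q' : Fin (n + 1)} (h : q ≤ p') :
    Disjoint (arrowsBetween p q) (arrowsBetween p' q') :=
  Set.disjoint_left.2 fun _ hl hl' => absurd (hl.2.trans_le (h.trans hl'.1)) (lt_irrefl _)

theorem arrowsBetween_union {p q r : Fin (n + 1)} (h : p ≤ q) (h' : q ≤ r) :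
    arrowsBetween q r ∪ arrowsBetween p q = arrowsBetween p r := by
  ext l
  simp only [arrowsBetween, Set.mem_union, Set.mem_ofPred_eq]
  constructor
  · rintro (hl | hl)
    · exact ⟨h.trans hl.1, hl.2⟩
    · exact ⟨hl.1, hl.2.trans_le h'⟩
  · intro hl
    by_cases e : q ≤ l.castSucc
    · exact Or.inl ⟨e, hl.2⟩
    · exact Or.inr ⟨hl.1, not_le.1 e⟩

theorem arrowsBetween_self (p : Fin (n + 1)) : arrowsBetween p p = ∅ :=
  Set.eq_empty_of_forall_notMem fun _ hl => absurd (hl.1.trans_lt hl.2) (lt_irrefl _)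

theorem arrowsBetween_succ (j : Fin n) : arrowsBetween j.castSucc j.succ = {j} := by
  ext l
  simp only [arrowsBetween, Set.mem_ofPred_eq, Set.mem_singleton_iff, Fin.le_def, Fin.lt_def,
    Fin.val_castSucc, Fin.val_succ, Fin.ext_iff]
  omega

theorem arrowsBetween_all : arrowsBetween (0 : Fin (n + 1)) (Fin.last n) = Set.univ :=
  Set.eq_univ_of_forall fun l => ⟨Fin.zero_le _, Fin.castSucc_lt_last l⟩

theorem arrowsBetween_iUnion {m : ℕ} (θ : Fin (m + 1) →o Fin (n + 1)) :
    ⋃ j : Fin m, arrowsBetween (θ j.castSucc) (θ j.succ) =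
      arrowsBetween (θ 0) (θ (Fin.last m)) := by
  have key : ∀ q : Fin (m + 1), ⋃ j ∈ {j : Fin m | j.castSucc < q},
      arrowsBetween (θ j.castSucc) (θ j.succ) = arrowsBetween (θ 0) (θ q) := by
    intro q
    induction q using Fin.induction with
    | zero => simp [arrowsBetween_self]
    | succ q ih =>
      rw [← arrowsBetween_union (θ.monotone (Fin.zero_le q.castSucc))
        (θ.monotone q.castSucc_lt_succ.le), ← ih]
      have : {j : Fin m | j.castSucc < q.succ} = insert q {j : Fin m | j.castSucc < q.castSucc} := by
        ext j
        simp only [Set.mem_ofPred_eq, Set.mem_insert_iff, Fin.lt_def, Fin.val_castSucc,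
          Fin.val_succ, Fin.ext_iff]
        omega
      rw [this, Set.biUnion_insert]
  rw [← key (Fin.last m)]
  simp [Fin.castSucc_lt_last]

theorem arrowsBetween_pairwise {m : ℕ} (θ : Fin (m + 1) →o Fin (n + 1)) (j j' : Fin m)
    (h : j ≠ j') : Disjoint (arrowsBetween (θ j.castSucc) (θ j.succ))
      (arrowsBetween (θ j'.castSucc) (θ j'.succ)) := by
  rcases lt_or_gt_of_ne h with h | h
  · exact arrowsBetween_disjoint (θ.monotone (Fin.succ_le_castSucc_iff.2 h))
  · exact (arrowsBetween_disjoint (θ.monotone (Fin.succ_le_castSucc_iff.2 h))).symm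

theorem multilinearOn_compSeg {p q : Fin (n + 1)} (h : p ≤ q) :
    MultilinearOn k (arrowsBetween p q) (fun f : Chain σ => compSeg f h) := by
  induction q using Fin.induction with
  | zero =>
    obtain rfl : p = 0 := le_antisymm h (Fin.zero_le p)
    simp only [compSeg_self]
    exact (MultilinearOn.const _).congr (arrowsBetween_self 0).symm
  | succ j ih =>
    by_cases hp : p ≤ j.castSucc
    · simp only [compSeg_succ _ j hp h]
      refine ((MultilinearOn.eval j).bilin (ih hp) ?_ _).congr ?_
      · rw [← arrowsBetween_succ]
        exact (arrowsBetween_disjoint le_rfl).symm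
      · rw [← arrowsBetween_succ]
        exact arrowsBetween_union hp j.castSucc_lt_succ.le
    · obtain rfl : p = j.succ := le_antisymm h (Fin.castSucc_lt_iff_succ_le.1 (not_le.1 hp))
      simp only [compSeg_self]
      exact (MultilinearOn.const _).congr (arrowsBetween_self _).symm

variable (a) in
/-- Hochschild cochains of degree `n`: a family, indexed by the `n`-simplices of `U^♯`, of multilinear
maps `a(A_{n-1}, A_n) ⊗ ⋯ ⊗ a(A_0, A_1) → a(A_0, A_n)`. -/
abbrev Cochain (n : ℕ) : Type u :=
  ∀ σ : ComposableArrows a.Sharp n,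
    MultilinearMap k (fun i : Fin n => seg σ i.castSucc_lt_succ.le) (seg σ (Fin.zero_le (Fin.last n)))

/-- The cosimplicial structure: `(θ φ)(f)` composes the `f_i` between consecutive values of `θ`, applies
`φ`, and composes the result with the remaining `f_i` on both sides. -/
def cofaceFun {m : ℕ} (θ : Fin (m + 1) →o Fin (n + 1)) (φ : Cochain a m)
    (σ : ComposableArrows a.Sharp n) (f : Chain σ) : seg σ (Fin.zero_le (Fin.last n)) :=
  segComp σ (Fin.zero_le (θ (Fin.last m))) (Fin.le_last _) (compSeg f (Fin.le_last _))
    (segComp σ (Fin.zero_le (θ 0)) (θ.monotone (Fin.zero_le _))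
      (φ (restrictSimplex θ σ) (restrictChain θ f)) (compSeg f (Fin.zero_le _)))

theorem multilinearOn_cofaceFun {m : ℕ} (θ : Fin (m + 1) →o Fin (n + 1)) (φ : Cochain a m)
    (σ : ComposableArrows a.Sharp n) : MultilinearOn k Set.univ (cofaceFun θ φ σ) := by
  have h := (MultilinearOn.comp (φ (restrictSimplex θ σ))
    (fun j => multilinearOn_compSeg (σ := σ) (θ.monotone j.castSucc_lt_succ.le))
    (arrowsBetween_pairwise θ)).congr (arrowsBetween_iUnion θ)
  have h₁ := (h.bilin (multilinearOn_compSeg (σ := σ) (Fin.zero_le (θ 0)))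
    (arrowsBetween_disjoint le_rfl).symm
    (segComp σ (Fin.zero_le (θ 0)) (θ.monotone (Fin.zero_le (Fin.last m))))).congr
    (arrowsBetween_union (Fin.zero_le _) (θ.monotone (Fin.zero_le _)))
  exact ((((multilinearOn_compSeg (σ := σ) (Fin.le_last (θ (Fin.last m)))).bilin h₁
    (arrowsBetween_disjoint le_rfl).symm
    (segComp σ (Fin.zero_le (θ (Fin.last m))) (Fin.le_last _))).congr
    (arrowsBetween_union (Fin.zero_le _) (Fin.le_last _)))).congr arrowsBetween_all

/-- The map on cochains given by `cofaceFun`. -/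
def coface {m : ℕ} (θ : Fin (m + 1) →o Fin (n + 1)) : Cochain a m →ₗ[k] Cochain a n where
  toFun φ σ := (multilinearOn_cofaceFun θ φ σ).toMultilinearMap
  map_add' φ ψ := by
    funext σ
    ext f
    exact ((segComp σ (Fin.zero_le (θ (Fin.last m))) (Fin.le_last _) (compSeg f (Fin.le_last _))) ∘ₗ
      (segComp σ (Fin.zero_le (θ 0)) (θ.monotone (Fin.zero_le _))).flip
        (compSeg f (Fin.zero_le _))).map_add _ _
  map_smul' c φ := by
    funext σ
    ext f
    exact ((segComp σ (Fin.zero_le (θ (Fin.last m))) (Fin.le_last _) (compSeg f (Fin.le_last _))) ∘ₗ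
      (segComp σ (Fin.zero_le (θ 0)) (θ.monotone (Fin.zero_le _))).flip
        (compSeg f (Fin.zero_le _))).map_smul _ _

theorem coface_apply {m : ℕ} (θ : Fin (m + 1) →o Fin (n + 1)) (φ : Cochain a m)
    (σ : ComposableArrows a.Sharp n) (f : Chain σ) : coface θ φ σ f = cofaceFun θ φ σ f := rfl

theorem coface_id : coface (a := a) (OrderHom.id (α := Fin (n + 1))) = LinearMap.id := by
  ext φ σ f
  rw [coface_apply, cofaceFun]
  have e : restrictChain (σ := σ) OrderHom.id f = f := funext fun j => compSeg_one f j
  rw [e]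
  erw [compSeg_self, compSeg_self, segId_segComp, segComp_segId]
  rfl

theorem coface_comp {l m : ℕ} (θ : Fin (l + 1) →o Fin (m + 1)) (η : Fin (m + 1) →o Fin (n + 1)) :
    coface (a := a) (η.comp θ) = (coface η).comp (coface θ) := by
  ext φ σ f
  rw [LinearMap.comp_apply, coface_apply, coface_apply, cofaceFun, cofaceFun, coface_apply,
    cofaceFun]
  have e : restrictChain (σ := restrictSimplex η σ) θ (restrictChain η f) =
      restrictChain (σ := σ) (η.comp θ) f :=
    funext fun j => compSeg_restrictChain η f (θ.monotone j.castSucc_lt_succ.le)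
  rw [e, compSeg_restrictChain, compSeg_restrictChain]
  have h₁ := compSeg_trans f (η.monotone (Fin.le_last (θ (Fin.last l)))) (Fin.le_last _)
  have h₂ := compSeg_trans f (Fin.zero_le (η 0)) (η.monotone (Fin.zero_le (θ 0)))
  have key : ∀ {p₀ p₁ p₂ p₃ p₄ p₅ : Fin (n + 1)} (h₁ : p₀ ≤ p₁) (h₂ : p₁ ≤ p₂) (h₃ : p₂ ≤ p₃)
      (h₄ : p₃ ≤ p₄) (h₅ : p₄ ≤ p₅) (x₁ : seg σ h₁) (x₂ : seg σ h₂) (x₃ : seg σ h₃)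
      (x₄ : seg σ h₄) (x₅ : seg σ h₅),
      segComp σ (h₁.trans (h₂.trans h₃)) (h₄.trans h₅) (segComp σ h₄ h₅ x₅ x₄)
        (segComp σ (h₁.trans h₂) h₃ x₃ (segComp σ h₁ h₂ x₂ x₁)) =
      segComp σ (h₁.trans (h₂.trans (h₃.trans h₄))) h₅ x₅ (segComp σ h₁ (h₂.trans (h₃.trans h₄))
        (segComp σ (h₂.trans h₃) h₄ x₄ (segComp σ h₂ h₃ x₃ x₂)) x₁) := by
    intro p₀ p₁ p₂ p₃ p₄ p₅ h₁ h₂ h₃ h₄ h₅ x₁ x₂ x₃ x₄ x₅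
    simp only [segComp_assoc]
  refine (congrArg₂ (fun z x => segComp σ (Fin.zero_le ((η.comp θ) (Fin.last l))) (Fin.le_last _) z
    (segComp σ (Fin.zero_le ((η.comp θ) 0)) ((η.comp θ).monotone (Fin.zero_le (Fin.last l)))
      (φ (restrictSimplex (η.comp θ) σ) (restrictChain (η.comp θ) f)) x)) h₁.symm h₂.symm).trans ?_
  exact key (Fin.zero_le (η 0)) (η.monotone (Fin.zero_le (θ 0)))
    (η.monotone (θ.monotone (Fin.zero_le _))) (η.monotone (Fin.le_last (θ (Fin.last l))))
    (Fin.le_last _) _ _ _ _ _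

variable (a) in
/-- The cosimplicial module of Hochschild cochains. -/
def cochains : CosimplicialObject (ModuleCat.{u} k) where
  obj n := ModuleCat.of k (Cochain a n.len)
  map θ := ModuleCat.ofHom (coface θ.toOrderHom)
  map_id n := by
    ext1
    exact coface_id
  map_comp θ η := by
    ext1
    exact coface_comp _ _

section Operations

/-- The cochain `y` of degree `n` evaluated on the `f_i` between the vertices `p` and `q = p + n`. -/
def evalAt {n : ℕ} (y : Cochain a n) {N : ℕ} (σ : ComposableArrows a.Sharp N) (f : Chain σ)
    (p q : Fin (N + 1)) (h : (p : ℕ) + n = q) :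
    seg σ (i := p) (j := q) (Fin.le_def.2 (h ▸ Nat.le_add_right _ _)) := by
  obtain ⟨q, hq⟩ := q
  obtain rfl : (p : ℕ) + n = q := h
  exact y (restrictSimplex ⟨fun i => ⟨p + i, by omega⟩, fun i j hij => by simpa using hij⟩ σ)
    (fun j => f ⟨p + j, by omega⟩)

theorem multilinearOn_evalAt {n : ℕ} (y : Cochain a n) {N : ℕ} (σ : ComposableArrows a.Sharp N)
    (p q : Fin (N + 1)) (h : (p : ℕ) + n = q) :
    MultilinearOn k (arrowsBetween p q) (fun f : Chain σ => evalAt y σ f p q h) := by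
  obtain ⟨q, hq⟩ := q
  obtain rfl : (p : ℕ) + n = q := h
  refine ((MultilinearOn.comp (y (restrictSimplex ⟨fun i => ⟨p + i, by omega⟩, fun i j hij => by simpa using hij⟩ σ)) (s := fun j : Fin n => {(⟨p + j, by omega⟩ : Fin N)})
    (fun j : Fin n => MultilinearOn.eval (⟨p + j, by omega⟩ : Fin N)) ?_)).congr ?_
  · intro j j' hj
    rw [Set.disjoint_singleton]
    intro e
    exact hj (Fin.ext (by simpa using e))
  · ext l
    simp only [Set.mem_iUnion, Set.mem_singleton_iff, arrowsBetween, Set.mem_ofPred_eq, Fin.le_def,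
      Fin.lt_def, Fin.val_castSucc, Fin.ext_iff]
    constructor
    · rintro ⟨j, hj⟩
      omega
    · intro hl
      exact ⟨⟨l - p, by omega⟩, by simp; omega⟩

/-- The cup product `(x ∪ y)(f) = (-1)^{pq} x(f_{p+q-1}, …, f_q) ∘ y(f_{q-1}, …, f_0)`. -/
def cup {p q : ℕ} (x : Cochain a p) (y : Cochain a q) : Cochain a (p + q) := fun σ =>
  (-1 : k) ^ (p * q) • (((multilinearOn_evalAt x σ ⟨q, by omega⟩ (Fin.last _) (by simp; omega)).bilin
    (multilinearOn_evalAt y σ 0 ⟨q, by omega⟩ (by simp)) (arrowsBetween_disjoint le_rfl).symm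
    (segComp σ (Fin.zero_le _) (Fin.le_last _))).congr ((arrowsBetween_union (Fin.zero_le _)
      (Fin.le_last _)).trans arrowsBetween_all)).toMultilinearMap

variable (a) in
/-- The cochain of degree one `f_0 ↦ f_0`. -/
def unitCochain : Cochain a 1 := fun σ =>
  ((MultilinearOn.eval (k := k) (M := fun i : Fin 1 => seg σ i.castSucc_lt_succ.le)
    (0 : Fin 1)).congr (Set.eq_univ_of_forall fun i => Subsingleton.elim i 0)).toMultilinearMap

/-- Transport of a segment along equalities of its end points. -/
def segCast {n : ℕ} (σ : ComposableArrows a.Sharp n) {i j i' j' : Fin (n + 1)} (hi : i = i')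
    (hj : j = j') (h : i ≤ j) (h' : i' ≤ j') : seg σ h ≃ₗ[k] seg σ h' := by
  subst hi hj
  exact LinearEquiv.refl k _

/-- The partial sums of the degrees of the cochains `z_0, …, z_{m-1}`. -/
def cutPoint {m : ℕ} (z : Fin m → Σ n, Cochain a n) : Fin (m + 1) → ℕ :=
  Fin.partialSum fun i => (z i).1

theorem cutPoint_monotone {m : ℕ} (z : Fin m → Σ n, Cochain a n) : Monotone (cutPoint z) :=
  Fin.monotone_iff_le_succ.2 fun i => by
    rw [cutPoint, Fin.partialSum_succ]
    exact Nat.le_add_right _ _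

/-- The partial sums of the degrees, as a monotone map. -/
def cutMap {m N : ℕ} (z : Fin m → Σ n, Cochain a n) (h : cutPoint z (Fin.last m) = N) :
    Fin (m + 1) →o Fin (N + 1) where
  toFun j := ⟨cutPoint z j, by
    have := cutPoint_monotone z (Fin.le_last j)
    omega⟩
  monotone' i j hij := cutPoint_monotone z hij

theorem cutMap_zero {m N : ℕ} (z : Fin m → Σ n, Cochain a n)
    (h : cutPoint z (Fin.last m) = N) : cutMap z h 0 = 0 :=
  Fin.ext (by simp [cutMap, cutPoint])

theorem cutMap_last {m N : ℕ} (z : Fin m → Σ n, Cochain a n)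
    (h : cutPoint z (Fin.last m) = N) : cutMap z h (Fin.last m) = Fin.last N := Fin.ext h

theorem cutMap_succ {m N : ℕ} (z : Fin m → Σ n, Cochain a n)
    (h : cutPoint z (Fin.last m) = N) (j : Fin m) :
    (cutMap z h j.castSucc : ℕ) + (z j).1 = cutMap z h j.succ := by
  simp [cutMap, cutPoint, Fin.partialSum_succ]

theorem multilinearOn_substitute {m N : ℕ} (x : Cochain a m) (z : Fin m → Σ n, Cochain a n)
    (h : cutPoint z (Fin.last m) = N) (σ : ComposableArrows a.Sharp N) :
    MultilinearOn k Set.univ (fun f : Chain σ => x (restrictSimplex (cutMap z h) σ)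
      (fun j => evalAt (z j).2 σ f _ _ (cutMap_succ z h j))) := by
  refine (MultilinearOn.comp (x (restrictSimplex (cutMap z h) σ))
    (fun j => multilinearOn_evalAt (z j).2 σ _ _ (cutMap_succ z h j))
    (arrowsBetween_pairwise (cutMap z h))).congr ?_
  rw [arrowsBetween_iUnion, cutMap_zero, cutMap_last, arrowsBetween_all]

/-- The cochain `x(z_{m-1}, …, z_0)` obtained by evaluating `x` on the values of the `z_i` on
consecutive blocks of arrows. -/
def substitute {m N : ℕ} (x : Cochain a m) (z : Fin m → Σ n, Cochain a n)
    (h : cutPoint z (Fin.last m) = N) : Cochain a N := fun σ =>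
  (segCast σ (cutMap_zero z h) (cutMap_last z h) ((cutMap z h).monotone (Fin.zero_le _))
    (Fin.zero_le _)).toLinearMap.compMultilinearMap
      (multilinearOn_substitute x z h σ).toMultilinearMap

/-- The cochains `y_t` placed at the positions `ι t`, and units elsewhere. -/
noncomputable def fillUnits {m r : ℕ} (y : Fin r → Σ n, Cochain a n) (ι : Fin r → Fin m) :
    Fin m → Σ n, Cochain a n :=
  Function.extend ι y fun _ => ⟨1, unitCochain a⟩

open Classical in
/-- The degree `N` component of the brace `x{y_1, …, y_r}`: the signed sum of all substitutions of the
`y_t` into `x`, `y_1` being the leftmost (last composed) one.  The sign is the sum over `t` of the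
shifted degree of `y_t` times the number of arguments to the left of `y_t`. -/
noncomputable def brace {m r : ℕ} (x : Cochain a m) (y : Fin r → Σ n, Cochain a n) (N : ℕ) :
    Cochain a N :=
  ∑ ι : Fin r → Fin m, if h : StrictAnti ι ∧ cutPoint (fillUnits y ι) (Fin.last m) = N then
    (-1 : k) ^ (∑ t, ((y t).1 + 1) * (N - cutPoint (fillUnits y ι) (ι t).succ)) •
      substitute x (fillUnits y ι) h.2
    else 0

end Operations

section Functoriality

variable {V : Type u} [SmallCategory V] {b : GradedCat k V}

/-- The functor on the categories `U^♯` induced by a graded functor. -/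
def GradedFunctor.sharp (F : GradedFunctor b a) : b.Sharp ⥤ a.Sharp where
  obj X := ⟨F.base.obj X.base, F.obj X.obj⟩
  map {X Y} f := F.base.map (X := X.base) (Y := Y.base) f
  map_id X := F.base.map_id X.base
  map_comp {X Y Z} f g := F.base.map_comp (X := X.base) (Y := Y.base) (Z := Z.base) f g

/-- The image of a simplex. -/
abbrev GradedFunctor.onSimplex (F : GradedFunctor b a) {n : ℕ} (σ : ComposableArrows b.Sharp n) :
    ComposableArrows a.Sharp n := σ ⋙ F.sharp

/-- The action of a graded functor on segments. -/
def segMap (F : GradedFunctor b a) {n : ℕ} (σ : ComposableArrows b.Sharp n) {i j : Fin (n + 1)}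
    (h : i ≤ j) : seg σ h →ₗ[k] seg (F.onSimplex σ) h :=
  F.map (X := (σ.obj i).base) (Y := (σ.obj j).base) (σ.map (homOfLE h)) _ _

theorem segMap_segComp (F : GradedFunctor b a) {n : ℕ} (σ : ComposableArrows b.Sharp n)
    {i j l : Fin (n + 1)} (h : i ≤ j) (h' : j ≤ l) (y : seg σ h') (x : seg σ h) :
    segMap F σ (h.trans h') (segComp σ h h' y x) =
      segComp (F.onSimplex σ) h h' (segMap F σ h' y) (segMap F σ h x) :=
  F.map_comp _ _ y x

theorem segMap_segId (F : GradedFunctor b a) {n : ℕ} (σ : ComposableArrows b.Sharp n)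
    (i : Fin (n + 1)) : segMap F σ (le_refl i) (segId σ i) = segId (F.onSimplex σ) i := by
  refine (F.map_reindex _ _ _ _).trans ?_
  refine (congrArg _ (F.map_id _)).trans ?_
  exact MapSc.reindex_trans a _ _ _ _ _

/-- The action of a graded functor on the elements over a simplex. -/
def mapChain (F : GradedFunctor b a) {n : ℕ} {σ : ComposableArrows b.Sharp n} (f : Chain σ) :
    Chain (F.onSimplex σ) := fun i => segMap F σ i.castSucc_lt_succ.le (f i)

theorem segMap_compSeg (F : GradedFunctor b a) {n : ℕ} {σ : ComposableArrows b.Sharp n}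
    (f : Chain σ) {p q : Fin (n + 1)} (h : p ≤ q) :
    segMap F σ h (compSeg f h) = compSeg (mapChain F f) h := by
  induction q using Fin.induction with
  | zero =>
    obtain rfl : p = 0 := le_antisymm h (Fin.zero_le p)
    rw [compSeg_self, compSeg_self, segMap_segId]
  | succ j ih =>
    by_cases hp : p ≤ j.castSucc
    · rw [compSeg_succ f j hp h, compSeg_succ (mapChain F f) j hp h, segMap_segComp, ih hp]
      rfl
    · obtain rfl : p = j.succ := le_antisymm h (Fin.castSucc_lt_iff_succ_le.1 (not_le.1 hp))
      rw [compSeg_self, compSeg_self, segMap_segId]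

/-- For a subcartesian functor, the action on segments is an isomorphism. -/
noncomputable def segEquiv {F : GradedFunctor b a} (hF : F.IsSubcartesian) {n : ℕ}
    (σ : ComposableArrows b.Sharp n) {i j : Fin (n + 1)} (h : i ≤ j) :
    seg σ h ≃ₗ[k] seg (F.onSimplex σ) h :=
  LinearEquiv.ofBijective (segMap F σ h) (hF _ _ _)

/-- The restriction `F^*φ = F⁻¹ ∘ φ ∘ (F ⊗ ⋯ ⊗ F)` along a subcartesian functor. -/
noncomputable def restrictCochain {F : GradedFunctor b a} (hF : F.IsSubcartesian) (n : ℕ) :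
    Cochain a n →ₗ[k] Cochain b n where
  toFun φ σ := (segEquiv hF σ (Fin.zero_le (Fin.last n))).symm.toLinearMap.compMultilinearMap
    ((φ (F.onSimplex σ)).compLinearMap fun i => segMap F σ i.castSucc_lt_succ.le)
  map_add' φ ψ := by
    funext σ
    ext f
    simp
  map_smul' c φ := by
    funext σ
    ext f
    simp

theorem restrictCochain_apply {F : GradedFunctor b a} (hF : F.IsSubcartesian) {n : ℕ}
    (φ : Cochain a n) (σ : ComposableArrows b.Sharp n) (f : Chain σ) :
    segMap F σ (Fin.zero_le (Fin.last n)) (restrictCochain hF n φ σ f) =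
      φ (F.onSimplex σ) (mapChain F f) :=
  (segEquiv hF σ (Fin.zero_le (Fin.last n))).apply_symm_apply _

theorem restrictCochain_ext {F : GradedFunctor b a} (hF : F.IsSubcartesian) {n : ℕ}
    {φ ψ : Cochain b n}
    (h : ∀ σ f, segMap F σ (Fin.zero_le (Fin.last n)) (φ σ f) =
      segMap F σ (Fin.zero_le (Fin.last n)) (ψ σ f)) : φ = ψ := by
  funext σ
  ext f
  exact (segEquiv hF σ (Fin.zero_le (Fin.last n))).injective (h σ f)

theorem restrictCochain_coface {F : GradedFunctor b a} (hF : F.IsSubcartesian) {m n : ℕ}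
    (θ : Fin (m + 1) →o Fin (n + 1)) (φ : Cochain a m) :
    restrictCochain hF n (coface θ φ) = coface θ (restrictCochain hF m φ) := by
  refine restrictCochain_ext hF fun σ f => ?_
  rw [restrictCochain_apply, coface_apply, coface_apply, cofaceFun, cofaceFun, segMap_segComp]
  refine Eq.trans ?_ (congrArg _ (segMap_segComp F σ (Fin.zero_le (θ 0))
    (θ.monotone (Fin.zero_le (Fin.last m))) _ _).symm)
  rw [segMap_compSeg, segMap_compSeg]
  have e : restrictChain θ (mapChain F f) = mapChain F (restrictChain θ f) :=
    funext fun j => (segMap_compSeg F f _).symm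
  have h := restrictCochain_apply hF φ (restrictSimplex θ σ) (restrictChain θ f)
  rw [← e] at h
  exact congrArg (fun z => segComp (F.onSimplex σ) (Fin.zero_le (θ (Fin.last m))) (Fin.le_last _)
    (compSeg (mapChain F f) (Fin.le_last _)) (segComp (F.onSimplex σ) (Fin.zero_le (θ 0))
      (θ.monotone (Fin.zero_le _)) z (compSeg (mapChain F f) (Fin.zero_le _)))) h.symm

end Functoriality

end Cochains

variable (k) in
/-- The cosimplicial modules of cochains as a contravariant functor on subcartesian functors. -/
noncomputable def cosimplicialCochains : (MapSc.{w, u} k)ᵒᵖ ⥤ CosimplicialObject (ModuleCat.{u} k) where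
  obj X := cochains X.unop.fib
  map F :=
    { app := fun n => ModuleCat.ofHom (restrictCochain (MapSc.Hom.sub F.unop) n.len)
      naturality := fun m n θ => by
        ext1
        refine LinearMap.ext fun φ => ?_
        exact restrictCochain_coface (MapSc.Hom.sub F.unop) θ.toOrderHom φ }
  map_id X := by
    ext n : 2
    refine LinearMap.ext fun φ => ?_
    refine restrictCochain_ext (MapSc.Hom.sub (𝟙 X.unop)) fun σ f => ?_
    exact restrictCochain_apply (MapSc.Hom.sub (𝟙 X.unop)) φ σ f
  map_comp {X Y Z} F G := by
    ext n : 2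
    refine LinearMap.ext fun φ => ?_
    refine restrictCochain_ext (MapSc.Hom.sub (G.unop ≫ F.unop)) fun σ f => ?_
    refine (restrictCochain_apply (MapSc.Hom.sub (G.unop ≫ F.unop)) φ σ f).trans ?_
    have h₁ := restrictCochain_apply (MapSc.Hom.sub G.unop)
      (restrictCochain (MapSc.Hom.sub F.unop) n.len φ) σ f
    have h₂ := restrictCochain_apply (MapSc.Hom.sub F.unop) φ
      ((MapSc.Hom.toFun G.unop).onSimplex σ) (mapChain (MapSc.Hom.toFun G.unop) f)
    rw [← h₁] at h₂
    exact h₂.symm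

variable (k) in
/-- The Hochschild complex `C(a)`, with differential the alternating sum of the cofaces, as a
contravariant functor on map-graded categories and subcartesian functors. -/
noncomputable def hochschild : (MapSc.{w, u} k)ᵒᵖ ⥤ CochainComplex (ModuleCat.{u} k) ℕ :=
  cosimplicialCochains k ⋙ AlgebraicTopology.alternatingCofaceMapComplex (ModuleCat.{u} k)

/-- Compatibility with the operations of the `B_∞`-structure of Hochschild complexes (besides the
differential): the cup product and the brace operations. -/
def PreservesOperations {V : Type u} [SmallCategory V] {b : GradedCat k V}
    (T : ∀ n : ℕ, Cochain a n →ₗ[k] Cochain b n) : Prop :=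
  (∀ (p q : ℕ) (x : Cochain a p) (y : Cochain a q), T (p + q) (cup x y) = cup (T p x) (T q y)) ∧
  ∀ (m r : ℕ) (x : Cochain a m) (y : Fin r → Σ n, Cochain a n) (N : ℕ),
    T N (brace x y N) = brace (T m x) (fun t => ⟨(y t).1, T (y t).1 (y t).2⟩) N

end Hochschild

/-- The Hochschild complex of the Grothendieck construction as a presheaf on `C` with a terminal object
`∗` adjoined. -/
noncomputable def MapPseudofunctor.hochschildPresheaf {k : Type w} [CommRing k] {C : Type u}
    [SmallCategory C] (P : MapPseudofunctor k C) :
    (WithTerminal C)ᵒᵖ ⥤ CochainComplex (ModuleCat.{u} k) ℕ :=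
  P.starFunctor.op ⋙ hochschild k

end MapGraded

open MapGraded

/-! A simplex of the Grothendieck construction over `C/X` amounts to a pair (σ, t): a simplex σ of
the total Grothendieck construction, lying over C_0 → ⋯ → C_n in `C`, and a morphism t : C_n → X.
The other structure morphisms C_j → X are forced, being the composites C_j → C_n → X. The modules
over (σ, t) are those over σ itself, so an n-cochain over `C/X` assigns to every pair (σ, t) an
element of a module N_σ of multilinear maps that does not depend on t. In these terms restriction
from ∗ sends y to (σ, t) ↦ y(σ), and restriction along c : X → Y sends x to (σ, t) ↦ x(σ, c ∘ t). In
each degree the presheaf on `C` is thus a product over σ of presheaves X ↦ Map(C(C_n, X), N_σ). This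
dictionary is `apply_lastCone`, `restrictOver_lastCone` and `restrictAlong_lastCone`.

Gluing follows (`exists_restrictOver_eq`). Let the x_i agree on the products, and take s : C_n → C_i
and s' : C_n → C_j. Then x_i(σ, s) and x_j(σ, s') are both the value at (σ, (s, s')) of the common
restriction to C_i × C_j, so they coincide. Hence y(σ) = x_i(σ, t) is independent of i and t, and
such a pair exists because C_n maps to some C_i. The same lifts of σ show that y is unique
(`restrictOver_jointly_injective`). The passage to complexes is formal: uniqueness in each degree
forces the glued maps to be linear and to commute with the differentials.

For the operations, F^*φ is characterised by F(F^*φ(f)) = φ(F f), since F is injective on the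
modules. The cup product and the braces are signed sums of expressions built by evaluating cochains
on consecutive arrows, composing, and inserting units. A graded functor respects each of these, and
the signs depend only on degrees. -/

namespace MapGraded

/-! ### Restriction maps, cup products and braces. -/

section Operations

variable {k : Type w} [CommRing k] {U V : Type u} [SmallCategory U] [SmallCategory V]
  {a : GradedCat k U} {b : GradedCat k V} {F : GradedFunctor b a} (hF : F.IsSubcartesian)

/-- Cutting out a block of arrows commutes with applying F, so this is the defining relation of F^*y
on the face spanned by the block. It is the one fact about evaluation that the cup product and the
braces need. -/
theorem segMap_evalAt {n : ℕ} (y : Cochain a n) {N : ℕ} (σ : ComposableArrows b.Sharp N)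
    (f : Chain σ) (p q : Fin (N + 1)) (h : (p : ℕ) + n = q) :
    segMap F σ (Fin.le_def.2 (h ▸ Nat.le_add_right _ _))
        (evalAt (restrictCochain hF n y) σ f p q h) =
      evalAt y (F.onSimplex σ) (mapChain F f) p q h := by
  -- Once the end point is literally `p + n`, `evalAt` contains no transport.
  obtain ⟨q, hq⟩ := q
  obtain rfl : (p : ℕ) + n = q := h
  exact restrictCochain_apply hF y (restrictSimplex ⟨fun i => ⟨p + i, by omega⟩,
    fun i j hij => by simpa using hij⟩ σ) (fun j => f ⟨p + j, by omega⟩)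

theorem cup_apply {p q : ℕ} (x : Cochain a p) (y : Cochain a q)
    (σ : ComposableArrows a.Sharp (p + q)) (f : Chain σ) :
    cup x y σ f = (-1 : k) ^ (p * q) • segComp σ (Fin.zero_le _) (Fin.le_last _)
      (evalAt x σ f ⟨q, by omega⟩ (Fin.last _) (by simp; omega))
      (evalAt y σ f 0 ⟨q, by omega⟩ (by simp)) := rfl

/-- After applying F, which loses nothing, both sides are the same signed composite of two block
values, because F preserves composition. -/
theorem restrictCochain_cup {p q : ℕ} (x : Cochain a p) (y : Cochain a q) :
    restrictCochain hF (p + q) (cup x y) =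
      cup (restrictCochain hF p x) (restrictCochain hF q y) := by
  refine restrictCochain_ext hF fun σ f => ?_
  rw [restrictCochain_apply, cup_apply, cup_apply, map_smul, ← segMap_evalAt hF x,
    ← segMap_evalAt hF y]
  exact congrArg _ (segMap_segComp F σ _ _ _ _).symm

theorem restrictCochain_unitCochain :
    restrictCochain hF 1 (unitCochain a) = unitCochain b := by
  refine restrictCochain_ext hF fun σ f => ?_
  rw [restrictCochain_apply]
  rfl

theorem segMap_segCast {n : ℕ} (σ : ComposableArrows b.Sharp n) {i j i' j' : Fin (n + 1)}
    (hi : i = i') (hj : j = j') (h : i ≤ j) (h' : i' ≤ j') (x : seg σ h) :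
    segMap F σ h' (segCast σ hi hj h h' x) =
      segCast (F.onSimplex σ) hi hj h h' (segMap F σ h x) := by
  subst hi hj
  rfl

theorem substitute_apply {m N : ℕ} (x : Cochain a m) (z : Fin m → Σ n, Cochain a n)
    (h : cutPoint z (Fin.last m) = N) (σ : ComposableArrows a.Sharp N) (f : Chain σ) :
    substitute x z h σ f =
      segCast σ (cutMap_zero z h) (cutMap_last z h) ((cutMap z h).monotone (Fin.zero_le _))
        (Fin.zero_le _) (x (restrictSimplex (cutMap z h) σ)
          (fun j => evalAt (z j).2 σ f _ _ (cutMap_succ z h j))) := rfl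

/-- The restriction of a cochain of arbitrary degree. -/
noncomputable def restrictSigma (z : Σ n, Cochain a n) : Σ n, Cochain b n :=
  ⟨z.1, restrictCochain hF z.1 z.2⟩

/-- After applying F, the inner values become those of the `z j` on the image simplex by
`segMap_evalAt`, and the outer one is the defining relation of F^*x on the simplex spanned by the
cut points. The same `h` serves on both sides because restriction keeps degrees, hence cut points.
-/
theorem restrictCochain_substitute {m N : ℕ} (x : Cochain a m) (z : Fin m → Σ n, Cochain a n)
    (h : cutPoint z (Fin.last m) = N) :
    restrictCochain hF N (substitute x z h) =
      substitute (restrictCochain hF m x) (restrictSigma hF ∘ z) h := by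
  refine restrictCochain_ext hF fun σ f => ?_
  rw [restrictCochain_apply, substitute_apply]
  refine Eq.trans ?_ (segMap_segCast σ (cutMap_zero z h) (cutMap_last z h)
    ((cutMap z h).monotone (Fin.zero_le _)) (Fin.zero_le _) _).symm
  refine congrArg (segCast (F.onSimplex σ) (cutMap_zero z h) (cutMap_last z h)
    ((cutMap z h).monotone (Fin.zero_le _)) (Fin.zero_le _)) ?_
  refine Eq.trans ?_ (restrictCochain_apply hF x (restrictSimplex (cutMap z h) σ) _).symm
  exact congrArg (x (restrictSimplex (cutMap z h) (F.onSimplex σ)))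
    (funext fun j => (segMap_evalAt hF (z j).2 σ f _ _ (cutMap_succ z h j)).symm)

/-- Restriction passes through `Function.extend`, and the default value is stable because the unit
cochain restricts to the unit cochain. -/
theorem fillUnits_restrictSigma {m r : ℕ} (y : Fin r → Σ n, Cochain a n) (ι : Fin r → Fin m) :
    fillUnits (restrictSigma hF ∘ y) ι = restrictSigma hF ∘ fillUnits y ι := by
  funext j
  refine Eq.trans ?_ (Function.apply_extend (restrictSigma hF) ι _ j).symm
  refine congrArg (fun e => Function.extend ι (restrictSigma hF ∘ y) e j) (funext fun _ => ?_)
  exact (congrArg (Sigma.mk 1) (restrictCochain_unitCochain hF)).symm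

theorem restrictCochain_brace {m r : ℕ} (x : Cochain a m) (y : Fin r → Σ n, Cochain a n)
    (N : ℕ) : restrictCochain hF N (brace x y N) =
      brace (restrictCochain hF m x) (restrictSigma hF ∘ y) N := by
  classical
  unfold brace
  rw [map_sum]
  refine Finset.sum_congr rfl fun ι _ => ?_
  -- The condition, the sign and the substitution all depend on the filled family, which is only
  -- propositionally the restricted one. Replacing it by a variable `z` lets the equality be
  -- eliminated in all places at once.
  have key : ∀ (z : Fin m → Σ n, Cochain b n), z = restrictSigma hF ∘ fillUnits y ι →
      restrictCochain hF N
        (if h : StrictAnti ι ∧ cutPoint (fillUnits y ι) (Fin.last m) = N then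
          (-1 : k) ^ (∑ t, ((y t).1 + 1) * (N - cutPoint (fillUnits y ι) (ι t).succ)) •
            substitute x (fillUnits y ι) h.2 else 0) =
        if h : StrictAnti ι ∧ cutPoint z (Fin.last m) = N then
          (-1 : k) ^ (∑ t, ((y t).1 + 1) * (N - cutPoint z (ι t).succ)) •
            substitute (restrictCochain hF m x) z h.2 else 0 := by
    rintro _ rfl
    by_cases h : StrictAnti ι ∧ cutPoint (fillUnits y ι) (Fin.last m) = N
    -- Cut points see only degrees, so the two conditions agree by computation; so do the signs.
    · have h' : StrictAnti ι ∧ cutPoint (restrictSigma hF ∘ fillUnits y ι) (Fin.last m) = N := h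
      rw [dif_pos h, dif_pos h', map_smul, restrictCochain_substitute]
      rfl
    · have h' : ¬ (StrictAnti ι ∧
        cutPoint (restrictSigma hF ∘ fillUnits y ι) (Fin.last m) = N) := h
      rw [dif_neg h, dif_neg h', map_zero]
  exact key _ (fillUnits_restrictSigma hF y ι)

theorem preservesOperations_restrictCochain :
    PreservesOperations (a := a) (b := b) fun n => restrictCochain hF n :=
  ⟨fun p q x y => restrictCochain_cup hF x y, fun m r x y N => restrictCochain_brace hF x y N⟩

end Operations

/-! ### Simplices over `C/X` as simplices with a cone, and gluing of cochains. -/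

namespace MapPseudofunctor

section Gluing

variable {k : Type w} [CommRing k] {C : Type u} [SmallCategory C] {P : MapPseudofunctor k C}

/-- The projection `C/X ⥤ C` is faithful and base change leaves the sets S_c unchanged. Equations
between morphisms over `C/X` can therefore be checked in the total construction. -/
theorem baseFunctor_forget_map_injective {X : C} {Y Z : Groth (P.precomp (Over.forget X))}
    {f g : Y ⟶ Z}
    (e : (P.baseFunctor (Over.forget X)).map f = (P.baseFunctor (Over.forget X)).map g) :
    f = g := by
  obtain ⟨⟨l, r, w⟩, s⟩ := f
  obtain ⟨⟨l', r', w'⟩, s'⟩ := g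
  obtain ⟨h₁, h₂⟩ := GrothHom.ext_iff.1 e
  obtain rfl : l = l' := h₁
  obtain rfl : r = r' := Subsingleton.elim _ _
  obtain rfl : s = s' := eq_of_heq h₂
  rfl

/-- A simplex of the Grothendieck construction of `P` with a cone from its points to `X`, as a simplex
of the Grothendieck construction of the restriction of `P` to `C/X`. -/
def coneLift {n : ℕ} (σ : ComposableArrows P.grothCat.Sharp n) {X : C}
    (h : ∀ j, (σ.obj j).base.pt ⟶ X)
    (w : ∀ {i j} (u : i ⟶ j), GrothHom.arr (P := P) (X := (σ.obj i).base)
      (Y := (σ.obj j).base) (σ.map u) ≫ h j = h i) :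
    ComposableArrows (P.precomp (Over.forget X)).grothCat.Sharp n where
  obj j := ⟨⟨Over.mk (h j), (σ.obj j).base.ob⟩, (σ.obj j).obj⟩
  map {i j} u := (⟨Over.homMk (GrothHom.arr (P := P) (X := (σ.obj i).base)
      (Y := (σ.obj j).base) (σ.map u)) (w u), GrothHom.elt (P := P) (X := (σ.obj i).base)
      (Y := (σ.obj j).base) (σ.map u)⟩ : GrothHom (P.precomp (Over.forget X))
        ⟨Over.mk (h i), (σ.obj i).base.ob⟩ ⟨Over.mk (h j), (σ.obj j).base.ob⟩)
  map_id i := by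
    -- Projected to the total construction, the functor laws are those of σ.
    refine baseFunctor_forget_map_injective (P := P) (X := X) ?_
    refine Eq.trans ?_ ((P.baseFunctor (Over.forget X)).map_id
      ⟨Over.mk (h i), (σ.obj i).base.ob⟩).symm
    exact σ.map_id i
  map_comp {i j l} u v := by
    refine baseFunctor_forget_map_injective (P := P) (X := X) ?_
    refine Eq.trans ?_ ((P.baseFunctor (Over.forget X)).map_comp
      (X := ⟨Over.mk (h i), (σ.obj i).base.ob⟩) (Y := ⟨Over.mk (h j), (σ.obj j).base.ob⟩)
      (Z := ⟨Over.mk (h l), (σ.obj l).base.ob⟩) _ _).symm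
    exact σ.map_comp u v


/-- Values on lifts of σ lie in a module of σ alone, so values for two cones can be compared without
transport. This absorbs cones that are equal without being so by definition. -/
theorem coneLift_congr {n : ℕ} (σ : ComposableArrows P.grothCat.Sharp n) {X : C}
    {h h' : ∀ j, (σ.obj j).base.pt ⟶ X} (e : h = h') (w) (w')
    (x : Cochain (P.precomp (Over.forget X)).grothCat n) (f : Chain σ) :
    (x (coneLift σ h w) f : seg σ (Fin.zero_le (Fin.last n))) = x (coneLift σ h' w') f := by
  subst e
  rfl

/-- The value of a cochain on the simplex `σ` with the cone given by a morphism from its last point. -/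
def lastCone {n : ℕ} (σ : ComposableArrows P.grothCat.Sharp n) {X : C}
    (t : (σ.obj (Fin.last n)).base.pt ⟶ X) :
    ComposableArrows (P.precomp (Over.forget X)).grothCat.Sharp n :=
  coneLift σ (fun j => GrothHom.arr (P := P) (X := (σ.obj j).base)
      (Y := (σ.obj (Fin.last n)).base) (σ.map (homOfLE (Fin.le_last j))) ≫ t)
    -- The cone identity is functoriality of σ for the composite from i through j to the last
    -- vertex.
    (fun {i j} u => by
      rw [← Category.assoc]
      exact congrArg (· ≫ t) (Groth.arr_comp (P := P) (σ.map_comp u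
        (homOfLE (Fin.le_last j))).symm))

/-- Base change is the identity on modules, so the F⁻¹ in F^* disappears and restriction is
evaluation on the image simplex. -/
theorem restrictCochain_baseChange_apply {D : Type u} [SmallCategory D] (Φ : D ⥤ C) {n : ℕ}
    (φ : Cochain P.grothCat n) (σ : ComposableArrows (P.precomp Φ).grothCat.Sharp n)
    (f : Chain σ) :
    restrictCochain (MapSc.Hom.sub (P.baseChange Φ)) n φ σ f =
      φ ((MapSc.Hom.toFun (P.baseChange Φ)).onSimplex σ) f :=
  restrictCochain_apply (MapSc.Hom.sub (P.baseChange Φ)) φ σ f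

variable (P) in
/-- The restriction of cochains from the Grothendieck construction of `P` to that over `C/X`. -/
noncomputable abbrev restrictOver (X : C) (n : ℕ) :
    Cochain P.grothCat n →ₗ[k] Cochain (P.precomp (Over.forget X)).grothCat n :=
  restrictCochain (MapSc.Hom.sub (P.baseChange (Over.forget X))) n

variable (P) in
/-- The restriction of cochains along `C/X ⥤ C/Y`. -/
noncomputable abbrev restrictAlong {X Y : C} (c : X ⟶ Y) (n : ℕ) :
    Cochain (P.precomp (Over.forget Y)).grothCat n →ₗ[k]
      Cochain (P.precomp (Over.forget X)).grothCat n :=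
  restrictCochain (MapSc.Hom.sub ((P.precomp (Over.forget Y)).baseChange (Over.map c))) n

/-- Arrows of `C/X` commute with the structure morphisms, so that of the last point determines all
the others. A simplex over `C/X` is therefore recovered from its image and this one morphism. -/
theorem apply_lastCone {n : ℕ} {X : C} (x : Cochain (P.precomp (Over.forget X)).grothCat n)
    (τ : ComposableArrows (P.precomp (Over.forget X)).grothCat.Sharp n) (f : Chain τ) :
    x (lastCone ((MapSc.Hom.toFun (P.baseChange (Over.forget X))).onSimplex τ)
      (τ.obj (Fin.last n)).base.pt.hom) f = x τ f :=
  coneLift_congr ((MapSc.Hom.toFun (P.baseChange (Over.forget X))).onSimplex τ)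
    (h' := fun j => (τ.obj j).base.pt.hom)
    (funext fun j => Over.w (GrothHom.arr (P := P.precomp (Over.forget X))
      (X := (τ.obj j).base) (Y := (τ.obj (Fin.last n)).base)
      (τ.map (homOfLE (Fin.le_last j))))) _
    (fun {i j} u => Over.w (GrothHom.arr (P := P.precomp (Over.forget X))
        (X := (τ.obj i).base) (Y := (τ.obj j).base) (τ.map u))) x f

/-- Pushing the cone of `t` forward along `c` gives the cone of `t ≫ c`, up to associativity. -/
theorem restrictAlong_lastCone {n : ℕ} {X Y : C} (c : X ⟶ Y)
    (x : Cochain (P.precomp (Over.forget Y)).grothCat n)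
    (σ : ComposableArrows P.grothCat.Sharp n) (t : (σ.obj (Fin.last n)).base.pt ⟶ X)
    (f : Chain σ) :
    (restrictAlong P c n x (lastCone σ t) f : seg σ (Fin.zero_le (Fin.last n))) =
      x (lastCone σ (t ≫ c)) f := by
  refine Eq.trans (restrictCochain_baseChange_apply (P := P.precomp (Over.forget Y)) (Over.map c)
    x (lastCone σ t) f) ?_
  refine coneLift_congr σ (h := fun j => (GrothHom.arr (P := P) (X := (σ.obj j).base)
      (Y := (σ.obj (Fin.last n)).base) (σ.map (homOfLE (Fin.le_last j))) ≫ t) ≫ c)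
      (funext fun j => Category.assoc _ _ _) (fun {i j} u => ?_) _ x f
  simp only [← Category.assoc]
  exact congrArg (fun z => (z ≫ t) ≫ c) (Groth.arr_comp (P := P) (σ.map_comp u
        (homOfLE (Fin.le_last j))).symm)

/-- Forgetting the cone gives back σ, so a cochain restricted from ∗ does not see `t`. -/
theorem restrictOver_lastCone {n : ℕ} {X : C} (y : Cochain P.grothCat n)
    (σ : ComposableArrows P.grothCat.Sharp n) (t : (σ.obj (Fin.last n)).base.pt ⟶ X)
    (f : Chain σ) :
    (restrictOver P X n y (lastCone σ t) f : seg σ (Fin.zero_le (Fin.last n))) = y σ f :=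
  restrictCochain_baseChange_apply (Over.forget X) y (lastCone σ t) f

/-- The last point of any σ maps to some `Ci i`; the resulting lift of σ carries the value of the
cochain at σ. -/
theorem restrictOver_jointly_injective {I : Type*} (Ci : I → C)
    (hCi : ∀ X : C, ∃ i, Nonempty (X ⟶ Ci i)) {n : ℕ} {y y' : Cochain P.grothCat n}
    (h : ∀ i, restrictOver P (Ci i) n y = restrictOver P (Ci i) n y') : y = y' := by
  funext σ
  ext f
  obtain ⟨i, ⟨t⟩⟩ := hCi (σ.obj (Fin.last n)).base.pt
  exact (restrictOver_lastCone y σ t f).symm.trans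
    ((congrArg (fun z : Cochain (P.precomp (Over.forget (Ci i))).grothCat n =>
      (z (lastCone σ t) f : seg σ (Fin.zero_le (Fin.last n)))) (h i)).trans
        (restrictOver_lastCone y' σ t f))

theorem exists_restrictOver_eq [Limits.HasFiniteProducts C] {I : Type*} (Ci : I → C)
    (hCi : ∀ X : C, ∃ i, Nonempty (X ⟶ Ci i)) {n : ℕ}
    (x : ∀ i, Cochain (P.precomp (Over.forget (Ci i))).grothCat n)
    (hx : ∀ i j, restrictAlong P (Limits.prod.fst : Ci i ⨯ Ci j ⟶ Ci i) n (x i) =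
      restrictAlong P (Limits.prod.snd : Ci i ⨯ Ci j ⟶ Ci j) n (x j)) :
    ∃ y : Cochain P.grothCat n, ∀ i, restrictOver P (Ci i) n y = x i := by
  choose ι hι using hCi
  let t : ∀ X : C, X ⟶ Ci (ι X) := fun X => (hι X).some
  -- The value at σ is read off from one arbitrarily chosen cone to a member of the family.
  let y : Cochain P.grothCat n := fun σ => x _ (lastCone σ (t _))
  -- The choice is immaterial: the pairing of `s` and `s'` is a cone to the product, and the common
  -- restriction there takes both values. The case `i = j` with `s ≠ s'` is included and is needed
  -- below.
  have indep : ∀ (σ : ComposableArrows P.grothCat.Sharp n) (i j : I)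
      (s : (σ.obj (Fin.last n)).base.pt ⟶ Ci i) (s' : (σ.obj (Fin.last n)).base.pt ⟶ Ci j)
      (f : Chain σ), (x i (lastCone σ s) f : seg σ (Fin.zero_le (Fin.last n))) =
        x j (lastCone σ s') f := by
    intro σ i j s s' f
    have h₁ := restrictAlong_lastCone (P := P) Limits.prod.fst (x i) σ (Limits.prod.lift s s') f
    have h₂ := restrictAlong_lastCone (P := P) Limits.prod.snd (x j) σ (Limits.prod.lift s s') f
    rw [Limits.prod.lift_fst] at h₁
    rw [Limits.prod.lift_snd] at h₂
    rw [hx i j] at h₁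
    exact h₁.symm.trans h₂
  refine ⟨y, fun i => ?_⟩
  funext τ
  ext f
  refine (restrictCochain_baseChange_apply (Over.forget (Ci i)) y τ f).trans ?_
  -- The cone chosen for `y` may differ from the structure morphism of the last point of τ, even for
  -- the same index; independence exchanges the two.
  exact (indep ((MapSc.Hom.toFun (P.baseChange (Over.forget (Ci i)))).onSimplex τ) (ι _) i (t _)
    (τ.obj (Fin.last n)).base.pt.hom f).trans (apply_lastCone (x i) τ f)

end Gluing

end MapPseudofunctor

/-! ### The restriction maps of the Hochschild presheaf made explicit. -/

namespace MapPseudofunctor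

variable {k : Type w} [CommRing k] {C : Type u} [SmallCategory C] (P : MapPseudofunctor k C)

/-- The terms of the alternating coface complex are the cosimplicial modules themselves, so
unfolding suffices; the differential plays no part. -/
theorem hochschildPresheaf_map_f {X Y : WithTerminal C} (f : X ⟶ Y) (n : ℕ) :
    ((P.hochschildPresheaf.map f.op).f n).hom =
      restrictCochain (a := (P.starFunctor.obj Y).fib) (b := (P.starFunctor.obj X).fib)
        (MapSc.Hom.sub (P.starFunctor.map f)) n := rfl

/-- On morphisms of `C`, `starFunctor` is base change along `Over.map c`; this makes the gluing
lemmas applicable to the presheaf. -/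
theorem hochschildPresheaf_map_incl {X Y : C} (c : X ⟶ Y) (n : ℕ)
    (y : (P.hochschildPresheaf.obj (op (WithTerminal.of Y))).X n) :
    (P.hochschildPresheaf.map (WithTerminal.incl.map c).op).f n y = restrictAlong P c n y :=
  congrArg (fun T : Cochain (P.precomp (Over.forget Y)).grothCat n →ₗ[k]
    Cochain (P.precomp (Over.forget X)).grothCat n => T y)
    (P.hochschildPresheaf_map_f (WithTerminal.incl.map c) n)

theorem hochschildPresheaf_existsUnique [Limits.HasFiniteProducts C] {I : Type*} (Ci : I → C)
    (hCi : ∀ X : C, ∃ i, Nonempty (X ⟶ Ci i)) (n : ℕ)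
    (x : ∀ i, (P.hochschildPresheaf.obj (op (WithTerminal.of (Ci i)))).X n)
    (hx : ∀ i j, (P.hochschildPresheaf.map
          (WithTerminal.incl.map (Limits.prod.fst : Ci i ⨯ Ci j ⟶ Ci i)).op).f n (x i) =
        (P.hochschildPresheaf.map
          (WithTerminal.incl.map (Limits.prod.snd : Ci i ⨯ Ci j ⟶ Ci j)).op).f n (x j)) :
    ∃! y : (P.hochschildPresheaf.obj (op WithTerminal.star)).X n,
      ∀ i, (P.hochschildPresheaf.map (WithTerminal.homFrom (Ci i)).op).f n y = x i := by
  obtain ⟨y, hy⟩ := exists_restrictOver_eq (P := P) Ci hCi (n := n) x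
    (fun i j => (P.hochschildPresheaf_map_incl _ n (x i)).symm.trans
      ((hx i j).trans (P.hochschildPresheaf_map_incl _ n (x j))))
  exact ⟨y, hy, fun y' hy' => restrictOver_jointly_injective (P := P) Ci hCi (n := n)
    fun i => (hy' i).trans (hy i).symm⟩

end MapPseudofunctor

/-! ### From gluing in each degree to gluing of morphisms of complexes. -/

/-- Unique gluing of elements in every degree gives unique gluing of morphisms of complexes. -/
theorem existsUnique_hom_of_existsUnique {k : Type w} [CommRing k] {I : Type*}
    {E K : CochainComplex (ModuleCat.{u} k) ℕ}
    {L : I → CochainComplex (ModuleCat.{u} k) ℕ}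
    {M : I → I → CochainComplex (ModuleCat.{u} k) ℕ} (ρ : ∀ i, K ⟶ L i)
    (p : ∀ i j, L i ⟶ M i j) (q : ∀ i j, L j ⟶ M i j)
    (h : ∀ (n : ℕ) (x : ∀ i, (L i).X n), (∀ i j, (p i j).f n (x i) = (q i j).f n (x j)) →
      ∃! y : K.X n, ∀ i, (ρ i).f n y = x i)
    (hρ : ∀ i j, ρ i ≫ p i j = ρ j ≫ q i j)
    (x : ∀ i, E ⟶ L i) (hx : ∀ i j, x i ≫ p i j = x j ≫ q i j) :
    ∃! y : E ⟶ K, ∀ i, y ≫ ρ i = x i := by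
  -- The restrictions of `y'` form a compatible family by `hρ`; both elements glue it.
  have inj : ∀ (n : ℕ) (y y' : K.X n), (∀ i, (ρ i).f n y = (ρ i).f n y') → y = y' := by
    intro n y y' e
    refine (h n (fun i => (ρ i).f n y') fun i j => ?_).unique e fun _ => rfl
    have := congrArg (fun g => g.f n y') (hρ i j)
    simpa using this
  have ex : ∀ (n : ℕ) (e : E.X n), ∃ y : K.X n, ∀ i, (ρ i).f n y = (x i).f n e := by
    intro n e
    refine (h n (fun i => (x i).f n e) fun i j => ?_).exists
    have := congrArg (fun g => g.f n e) (hx i j)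
    simpa using this
  choose y hy using ex
  -- Elementwise gluings are additive and homogeneous because this holds after every `ρ i`, and the
  -- `ρ i` are jointly injective.
  let φ : ∀ n, E.X n ⟶ K.X n := fun n => ModuleCat.ofHom
    { toFun := y n
      map_add' := fun e e' => inj n _ _ fun i => by simp [hy]
      map_smul' := fun c e => inj n _ _ fun i => by simp [hy] }
  have hφ : ∀ n e i, (ρ i).f n (φ n e) = (x i).f n e := hy
  refine ⟨{ f := φ, comm' := fun m n _ => ?_ }, fun i => ?_, fun ψ hψ => ?_⟩
  -- Commutation with the differential is also tested after each `ρ i`, where both sides become `x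
  -- i` applied to the differential of `e`.
  · ext e
    refine inj n _ _ fun i => ?_
    have h₁ := ConcreteCategory.congr_hom ((ρ i).comm m n) (φ m e)
    have h₂ := ConcreteCategory.congr_hom ((x i).comm m n) e
    simp only [ConcreteCategory.comp_apply] at h₁ h₂ ⊢
    rw [hφ, ← h₂, ← h₁, hφ]
  · ext n e
    exact hφ n e i
  · ext n e
    refine inj n _ _ fun i => ?_
    refine Eq.trans ?_ (hφ n e i).symm
    rw [← hψ i]
    rfl

end MapGraded

theorem mainTheorem4 {k : Type w} [CommRing k] {C : Type u} [SmallCategory C]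
    [Limits.HasFiniteProducts C] (P : MapPseudofunctor k C) {I : Type*} (Ci : I → C)
    (hCi : ∀ X : C, ∃ i, Nonempty (X ⟶ Ci i)) :
    (∀ {X Y : WithTerminal C} (f : X ⟶ Y), PreservesOperations (a := (P.starFunctor.obj Y).fib)
      (b := (P.starFunctor.obj X).fib) fun n => ((P.hochschildPresheaf.map f.op).f n).hom) ∧
    (∀ E : CochainComplex (ModuleCat.{u} k) ℕ,
      Presieve.IsSheafFor (P.hochschildPresheaf ⋙ coyoneda.obj (op E))
        (Presieve.ofArrows (fun i => WithTerminal.of (Ci i))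
          fun i => WithTerminal.homFrom (Ci i))) ∧
    ∀ (n : ℕ) (x : ∀ i, (P.hochschildPresheaf.obj (op (WithTerminal.of (Ci i)))).X n),
      (∀ i j, (P.hochschildPresheaf.map
          (WithTerminal.incl.map (Limits.prod.fst : Ci i ⨯ Ci j ⟶ Ci i)).op).f n (x i) =
        (P.hochschildPresheaf.map
          (WithTerminal.incl.map (Limits.prod.snd : Ci i ⨯ Ci j ⟶ Ci j)).op).f n (x j)) →
      ∃! y : (P.hochschildPresheaf.obj (op WithTerminal.star)).X n,
        ∀ i, (P.hochschildPresheaf.map (WithTerminal.homFrom (Ci i)).op).f n y = x i := by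
  refine ⟨fun f => preservesOperations_restrictCochain (MapSc.Hom.sub (P.starFunctor.map f)), fun E => ?_,
    P.hochschildPresheaf_existsUnique Ci hCi⟩
  refine (Presieve.isSheafFor_arrows_iff (P.hochschildPresheaf ⋙ coyoneda.obj (op E))
    (X := fun i => WithTerminal.of (Ci i)) (fun i => WithTerminal.homFrom (Ci i))).2 ?_
  intro x hx
  exact existsUnique_hom_of_existsUnique
    (fun i => P.hochschildPresheaf.map (WithTerminal.homFrom (Ci i)).op)
    (fun i j => P.hochschildPresheaf.map
      (WithTerminal.incl.map (Limits.prod.fst : Ci i ⨯ Ci j ⟶ Ci i)).op)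
    (fun i j => P.hochschildPresheaf.map
      (WithTerminal.incl.map (Limits.prod.snd : Ci i ⨯ Ci j ⟶ Ci j)).op)
    (P.hochschildPresheaf_existsUnique Ci hCi)
    -- Both composites from the product to ∗ are the unique morphism to a terminal object.
    (fun i j => by
      rw [← Functor.map_comp, ← Functor.map_comp]
      rfl) x
    -- Compatibility is given for all test objects over ∗; the product alone suffices.
    (fun i j => hx i j (WithTerminal.of (Ci i ⨯ Ci j)) (WithTerminal.incl.map Limits.prod.fst)
      (WithTerminal.incl.map Limits.prod.snd) rfl)
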